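/- Fix $0<\alpha<2$, $\varepsilon>0$, and real numbers $K,M$. Put $C_\alpha=\frac{\alpha}{2^{1-\alpha}\sqrt{\pi}}\frac{\Gamma((1+\alpha)/2)}{\Gamma(1-\alpha/2)}$ and let $\zeta$ be the Riemann zeta function. *Equation.* Let $T>0$ and let $p:\mathbb R\times[0,T]\to\mathbb R$ be a classical solution of the nonlocal Fokker–Planck equation (without drift and without Gaussian diffusion) $$p_t(x,t)=\int_{\mathbb R\setminus\{0\}}\bigl[p(x+y,t)-p(x,t)-\mathbf 1_{\{|y|<1\}}\,y\,p_x(x,t)\bigr]\frac{\varepsilon C_\alpha\,dy}{|y|^{1+\alpha}}$$ with the natural far-field condition: for every $t\in[0,T]$, $p(x,t)\to0$ as $|x|\to\infty$, $p(\cdot,t)$ is integrable and $\int_{\mathbb R}p(x,t)\,dx=1$. Assume that $p$ is $C^4$ in $x$ and $C^2$ in $t$, with $|\partial_x^kp|\le K$ for $0\le k\le4$ and $|\partial_t^2p|\le K$ on $\mathbb R\times[0,T]$. *Scheme.* For $h,\Delta t>0$ and an integer $J\ge1$ put $L=Jh$, $x_j=jh$, $t_n=n\Delta t$. A numerical solution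 $(U_j^n)_{|j|\le J,\,n\ge0}$ satisfies $U_j^0=p(x_j,0)$ for $|j|<J$, and for all $n\ge 0$, $|j|<J$ $$U_j^{n+1}=U_j^n-\Delta t\,\varepsilon C_\alpha\zeta(\alpha-1)h^{-\alpha}(U_{j-1}^n-2U_j^n+U_{j+1}^n)+\Delta t\,\varepsilon C_\alpha h\sum_{k=-J-j,\;k\ne0}^{J-j}{}^{\!\!\!\prime\prime}\;\frac{U_{j+k}^n-U_j^n}{|x_k|^{1+\alpha}},$$ where $\sum''$ means that the terms of the two end indices $k=\pm J-j$ are halved. The values $U^n_{\pm J}$ at the two end nodes, for which the scheme gives no equation, may be chosen arbitrarily subject to $|U^n_{\pm J}|\le M$ (for example $U^n_{\pm J}=0$). Let $T_j^n$ be the truncation error, i.e. the left-hand side minus the right-hand side of the scheme with $p(x_j,t_n)$ in place of $U_j^n$, divided by $\Delta t$, and let $e_j^n=U_j^n-p(x_j,t_n)$. Consider the step condition $$\frac{\Delta t}{h^\alpha}\le\frac1{2\varepsilon C_\alpha\left[1+\frac1\alpha-\zeta(\alpha-1)\right]}.\qquad(\ast)$$ **Proposition.** There is a constant $C\ge 0$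 depending only on $\alpha,\varepsilon,K,M$ (not on $T,p,h,\Delta t,L,n,j$) such that, for all $T$ and $p$ as above, the following hold. In (1) and (3), $0<h\le1\le L$ and $\bar T:=C\,(\Delta t+h^2+L^{-\alpha})$. 1. (Truncation error.) $|T_j^n|\le\bar T$ whenever $t_{n+1}\le T$ and $|x_j|\le L/2$. 2. (Error bound from the maximum principle.) Assume $(\ast)$, let $U$ be a numerical solution and let $n\ge 0$. If $|T^m_j|\le\tau$ for all $m<n$, $|j|<J$, and $|e^m_{\pm J}|\le\beta$ for all $m\le n$, then $|e_j^n|\le\beta+n\Delta t\,\tau$ for all $|j|\le J$. 3. (Error bound with rate.) Assume $(\ast)$ and let $U$ be a numerical solution. Then $$E^n:=\max_{|x_j|\le L/2}|e_j^n|\le n\Delta t\,\bar T\qquad\text{whenever }t_n\le T.$$ 4. (Convergence.) Along every sequence $(h_m,\Delta t_m,J_m)_{m}$ that satisfies $(\ast)$ for every $m$, with $h_m\to0$ and $L_m=J_mh_m\to\infty$, and for all corresponding numerical solutions (with the same bound $M$), the error $e_j^n$ tends to $0$ as $m\to\infty$, uniformly over all $n,j$ with $t_n\le T$ and $|x_j|\le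 L_m/2$. -/

import Mathlib

open Set Filter Topology MeasureTheory

noncomputable section

namespace NonlocalFP

/-- The constant `C_α = α / (2^(1-α) √π) * Γ((1+α)/2) / Γ(1-α/2)` of the symmetric
`α`-stable jump measure `ν_α(dy) = C_α |y|^(-(1+α)) dy`. -/
def levyConst (α : ℝ) : ℝ :=
  α / ((2 : ℝ) ^ (1 - α) * Real.sqrt Real.pi) *
    (Real.Gamma ((1 + α) / 2) / Real.Gamma (1 - α / 2))

/-- The value `ζ(α - 1)` of the Riemann zeta function, a real number for real `α ≠ 2`. -/
def zetaConst (α : ℝ) : ℝ := (riemannZeta ((α : ℂ) - 1)).re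

/-- The spatial operator of the nonlocal Fokker-Planck equation with drift `f`, diffusion
constant `d`, jump intensity `ε` and index `α`, applied to `u` at `x`:
`-(f u)' + (d/2) u'' + ∫_{y ≠ 0} [u(x+y) - u(x) - 1_{|y|<1} y u'(x)] ε ν_α(dy)`. -/
def fokkerPlanckRHS (f : ℝ → ℝ) (d α ε : ℝ) (u : ℝ → ℝ) (x : ℝ) : ℝ :=
  -deriv (fun y => f y * u y) x + d / 2 * iteratedDeriv 2 u x +
    ∫ y in ({0}ᶜ : Set ℝ),
      (u (x + y) - u x - (if |y| < 1 then y * deriv u x else 0)) *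
        (ε * (levyConst α * |y| ^ (-(1 + α))))

/-- `p x t` solves, on `ℝ × [0, T]`, the nonlocal Fokker-Planck equation without drift and
Gaussian diffusion, under the natural far-field condition (decay at infinity, unit mass). -/
structure IsNaturalSolution (α ε T : ℝ) (p : ℝ → ℝ → ℝ) : Prop where
  equation : ∀ x, ∀ t ∈ Icc 0 T,
    HasDerivWithinAt (fun s => p x s)
      (fokkerPlanckRHS (fun _ => 0) 0 α ε (fun y => p y t) x) (Icc 0 T) t
  decay : ∀ t ∈ Icc 0 T, Tendsto (fun x => p x t) (cocompact ℝ) (𝓝 0)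
  integrable : ∀ t ∈ Icc 0 T, Integrable (fun x => p x t)
  mass : ∀ t ∈ Icc 0 T, ∫ x, p x t = 1

/-- The smoothness used in the truncation error: `p` is `C⁴` in space and `C²` in time, and
`∂ₓᵏ p` (`k ≤ 4`) and `∂ₜ² p` are bounded by `K` on `ℝ × [0, T]`. -/
structure IsBoundedSmooth (K T : ℝ) (p : ℝ → ℝ → ℝ) : Prop where
  contDiff_space : ∀ t ∈ Icc 0 T, ContDiff ℝ 4 (fun x => p x t)
  bound_space : ∀ t ∈ Icc 0 T, ∀ k : ℕ, k ≤ 4 → ∀ x,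
    |iteratedDeriv k (fun y => p y t) x| ≤ K
  contDiff_time : ∀ x, ContDiffOn ℝ 2 (fun s => p x s) (Icc 0 T)
  bound_time : ∀ x, ∀ t ∈ Icc 0 T,
    |iteratedDerivWithin 2 (fun s => p x s) (Icc 0 T) t| ≤ K

/-- The sum `∑''` over `k ≠ 0`, `-J-j ≤ k ≤ J-j`, of `(V_{j+k} - V_j) / |x_k|^(1+α)`, where
`x_k = k h` and the terms of the two end indices carry the weight `1/2`. -/
def trapezoidSum (α h : ℝ) (J : ℕ) (V : ℤ → ℝ) (j : ℤ) : ℝ :=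
  ∑ k ∈ (Finset.Icc (-(J : ℤ) - j) ((J : ℤ) - j)).erase 0,
    (if k = -(J : ℤ) - j ∨ k = (J : ℤ) - j then (1 / 2 : ℝ) else 1) *
      ((V (j + k) - V j) / |(k : ℝ) * h| ^ (1 + α))

/-- One forward Euler step of the scheme on `[-L, L]`, `L = J h`, at the node `x_j = j h`. -/
def eulerStep (α ε h Δt : ℝ) (J : ℕ) (V : ℤ → ℝ) (j : ℤ) : ℝ :=
  V j - Δt * ε * levyConst α * zetaConst α * h ^ (-α) * (V (j - 1) - 2 * V j + V (j + 1)) +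
    Δt * ε * levyConst α * h * trapezoidSum α h J V j

/-- The restriction on the refinement path. -/
def StepCondition (α ε h Δt : ℝ) : Prop :=
  Δt / h ^ α ≤ 1 / (2 * ε * levyConst α * (1 + 1 / α - zetaConst α))

/-- `U n j` is a numerical solution started from `p (·) 0`: the scheme holds at all interior
nodes `|j| < J`. The scheme gives no equation at the two end nodes `±J`; the values used there
may come from any closure (for instance zero), as long as they are bounded by `M`. -/
structure IsNumericalSolution (α ε h Δt M : ℝ) (J : ℕ) (p : ℝ → ℝ → ℝ) (U : ℕ → ℤ → ℝ) :
    Prop where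
  initial : ∀ j : ℤ, |j| < (J : ℤ) → U 0 j = p (j * h) 0
  step : ∀ (n : ℕ) (j : ℤ), |j| < (J : ℤ) → U (n + 1) j = eulerStep α ε h Δt J (U n) j
  ends : ∀ (n : ℕ) (j : ℤ), |j| = (J : ℤ) → |U n j| ≤ M

/-- The truncation error `T_j^n`: the difference of the two sides of the scheme at
`(x_j, t_n) = (j h, n Δt)` when the analytic solution is inserted, divided by `Δt`. -/
def truncationError (α ε h Δt : ℝ) (J : ℕ) (p : ℝ → ℝ → ℝ) (n : ℕ) (j : ℤ) : ℝ :=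
  (p (j * h) ((n + 1) * Δt) -
    eulerStep α ε h Δt J (fun i => p (i * h) (n * Δt)) j) / Δt

/-- The error `e_j^n = U_j^n - p(x_j, t_n)`. -/
def gridError (h Δt : ℝ) (p : ℝ → ℝ → ℝ) (U : ℕ → ℤ → ℝ) (n : ℕ) (j : ℤ) : ℝ :=
  U n j - p (j * h) (n * Δt)

end NonlocalFP

end

open NonlocalFP

/-!
The four claims rest on monotonicity of the Euler step and on a consistency estimate.

*Consistency.* Pairing `y` with `-y` turns the nonlocal operator at `x` into `ε C_α` times the
integral over `(0, ∞)` of the second difference `u(x+y) + u(x-y) - 2u(x)` against `y^(-1-α)`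
(`HasBoundedDerivs.fokkerPlanckRHS_eq`). The second difference is
`u''(x) y²` plus a remainder of order `y⁴`. For the remainder the trapezoidal rule has an error of
order `h²`, by the Peano kernel estimate
`norm_sum_trapezoid_sub_integral_le`. For the leading part one needs the trapezoidal rule for the
power `y^(1-α)`: its error on `[0, m]` is `ζ(α-1) + O(m^(-α))` (`abs_powerTrapezoid_sub_le`),
because the Euler-Maclaurin approximations of zeta converge on `Re s > -1`, by analytic
continuation (`tendsto_zetaPartial`). The zeta term of the scheme cancels precisely this error.
What the symmetric pairing leaves over, and the integral beyond the grid, are tails of `y^(-1-α)`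
beyond the distance of `x` to the nearer end; they are `O(L^(-α))` for `|x| < 3L/4`.

*Stability.* As `ζ(α-1) ≤ 0` and `∑ k^(-1-α) ≤ 1 + 1/α`, the step condition ensures that the
coefficients of the Euler step are nonnegative (`eulerStep_nonneg`). They add up to one, whence the
discrete maximum principle and the second claim.

*Rate.* At the end nodes the error is merely bounded, and close to them the truncation error is not
small, so the maximum principle on the whole grid gives no rate. Instead the error is compared with
`t_n C T̄` plus a multiple of the barrier `16 dist(x/L, [-1/2, 1/2])²`
(`abs_gridError_le_add_barrier`). For `|x| ≥ 3L/4` the comparison is the trivial bound of the error;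
for `|x| < 3L/4` the truncation error is at most `C T̄`, and the discrete operator maps the barrier
to `O(L^(-α))`. For `|x| ≤ L/2` the barrier vanishes. Convergence follows, since the step condition
and `h → 0` force `Δt → 0`.
-/

namespace NonlocalFP

/-! ### The trapezoidal rule -/

/-- Peano kernel form of the error of the trapezoidal rule on one interval. -/
theorem trapezoid_sub_integral {E : Type*} [NormedAddCommGroup E] [NormedSpace ℝ E]
    [CompleteSpace E] {f f' f'' : ℝ → E} {a b : ℝ}
    (hf : ∀ x ∈ uIcc a b, HasDerivAt f (f' x) x)
    (hf' : ∀ x ∈ uIcc a b, HasDerivAt f' (f'' x) x) (hf'' : ContinuousOn f'' (uIcc a b)) :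
    ((b - a) / 2) • (f a + f b) - ∫ x in a..b, f x =
      ∫ x in a..b, ((x - a) * (b - x) / 2) • f'' x := by
  have hfc : ContinuousOn f (uIcc a b) := fun x hx => (hf x hx).continuousAt.continuousWithinAt
  have hw : ContinuousOn (fun x : ℝ => ((x - a) * (b - x) / 2) • f'' x) (uIcc a b) :=
    ContinuousOn.smul (by fun_prop) hf''
  have key : ∀ x ∈ uIcc a b, HasDerivAt
      (fun x => ((x - a) * (b - x) / 2) • f' x - ((a + b) / 2 - x) • f x)
      (((x - a) * (b - x) / 2) • f'' x + f x) x := by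
    intro x hx
    have h1 : HasDerivAt (fun x : ℝ => (x - a) * (b - x) / 2) ((a + b) / 2 - x) x := by
      have := (((hasDerivAt_id x).sub_const a).mul ((hasDerivAt_id x).const_sub b)).div_const 2
      refine this.congr_deriv ?_
      simp; ring
    have h2 : HasDerivAt (fun x : ℝ => (a + b) / 2 - x) (-1) x :=
      (hasDerivAt_id x).const_sub _
    refine ((h1.smul (hf' x hx)).sub (h2.smul (hf x hx))).congr_deriv ?_
    module
  have := intervalIntegral.integral_eq_sub_of_hasDerivAt key
    ((hw.add hfc).intervalIntegrable)
  rw [intervalIntegral.integral_add hw.intervalIntegrable hfc.intervalIntegrable] at this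
  rw [eq_sub_of_add_eq this]
  module

theorem norm_trapezoid_sub_integral_le {E : Type*} [NormedAddCommGroup E] [NormedSpace ℝ E]
    [CompleteSpace E] {f f' f'' : ℝ → E} {g : ℝ → ℝ} {a b : ℝ} (hab : a ≤ b)
    (hf : ∀ x ∈ Icc a b, HasDerivAt f (f' x) x)
    (hf' : ∀ x ∈ Icc a b, HasDerivAt f' (f'' x) x) (hf'' : ContinuousOn f'' (Icc a b))
    (hg : IntervalIntegrable g volume a b) (hfg : ∀ x ∈ Icc a b, ‖f'' x‖ ≤ g x) :
    ‖((b - a) / 2) • (f a + f b) - ∫ x in a..b, f x‖ ≤ (b - a) ^ 2 / 8 * ∫ x in a..b, g x := by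
  rw [← uIcc_of_le hab] at hf hf' hf''
  rw [trapezoid_sub_integral hf hf' hf'', ← intervalIntegral.integral_const_mul]
  refine intervalIntegral.norm_integral_le_of_norm_le hab (ae_of_all _ fun x hx => ?_)
    (hg.const_mul _)
  have h1 : 0 ≤ (x - a) * (b - x) := mul_nonneg (by linarith [hx.1]) (by linarith [hx.2])
  rw [norm_smul, Real.norm_of_nonneg (by positivity)]
  have h2 : (x - a) * (b - x) / 2 ≤ (b - a) ^ 2 / 8 := by
    nlinarith [sq_nonneg ((x - a) - (b - x))]
  exact mul_le_mul h2 (hfg x ⟨hx.1.le, hx.2⟩) (norm_nonneg _) (by positivity)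

/-- Error of the composite trapezoidal rule with nodes `k h`, `m ≤ k ≤ n`, in terms of the integral
of a majorant of `‖f''‖`. Unlike a bound by `sup ‖f''‖`, it stays useful for an `f''` that blows up
towards `0` and decays at infinity. -/
theorem norm_sum_trapezoid_sub_integral_le {E : Type*} [NormedAddCommGroup E] [NormedSpace ℝ E]
    [CompleteSpace E] {f f' f'' : ℝ → E} {g : ℝ → ℝ} {h : ℝ} (hh : 0 ≤ h) {m n : ℕ} (hmn : m ≤ n)
    (hf : ∀ x ∈ Icc (m * h) (n * h), HasDerivAt f (f' x) x)
    (hf' : ∀ x ∈ Icc (m * h) (n * h), HasDerivAt f' (f'' x) x)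
    (hf'' : ContinuousOn f'' (Icc (m * h) (n * h)))
    (hg : IntervalIntegrable g volume (m * h) (n * h))
    (hfg : ∀ x ∈ Icc (m * h) (n * h), ‖f'' x‖ ≤ g x) :
    ‖∑ k ∈ Finset.Ico m n, (h / 2) • (f (k * h) + f ((k + 1 : ℕ) * h)) -
      ∫ x in (m * h)..(n * h), f x‖ ≤ h ^ 2 / 8 * ∫ x in (m * h)..(n * h), g x := by
  have hle : ∀ k : ℕ, (k : ℝ) * h ≤ (k + 1 : ℕ) * h := fun k => by push_cast; nlinarith
  have hsub : ∀ k ∈ Ico m n, Icc ((k : ℝ) * h) ((k + 1 : ℕ) * h) ⊆ Icc (m * h) (n * h) := by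
    intro k hk
    refine Icc_subset_Icc ?_ ?_
    · exact mul_le_mul_of_nonneg_right (by exact_mod_cast hk.1) hh
    · exact mul_le_mul_of_nonneg_right (by exact_mod_cast hk.2) hh
  have hfi : ∀ k ∈ Ico m n, IntervalIntegrable f volume (k * h) ((k + 1 : ℕ) * h) := by
    intro k hk
    refine ContinuousOn.intervalIntegrable_of_Icc (hle k) fun x hx => ?_
    exact (hf x (hsub k hk hx)).continuousAt.continuousWithinAt
  have hgi : ∀ k ∈ Ico m n, IntervalIntegrable g volume (k * h) ((k + 1 : ℕ) * h) := by
    intro k hk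
    refine hg.mono_set ?_
    rw [uIcc_of_le (hle k), uIcc_of_le (mul_le_mul_of_nonneg_right (by exact_mod_cast hmn) hh)]
    exact hsub k hk
  rw [← intervalIntegral.sum_integral_adjacent_intervals_Ico
      (a := fun k : ℕ => (k : ℝ) * h) hmn hfi,
    ← intervalIntegral.sum_integral_adjacent_intervals_Ico (a := fun k : ℕ => (k : ℝ) * h) hmn hgi,
    ← Finset.sum_sub_distrib, Finset.mul_sum]
  refine norm_sum_le_of_le _ fun k hk => ?_
  rw [Finset.mem_Ico] at hk
  have hs := hsub k hk
  have hd : ((k + 1 : ℕ) : ℝ) * h - k * h = h := by push_cast; ring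
  have := norm_trapezoid_sub_integral_le (hle k) (fun x hx => hf x (hs hx))
    (fun x hx => hf' x (hs hx)) (hf''.mono hs) (hgi k hk) (fun x hx => hfg x (hs hx))
  rwa [hd] at this

/-! ### Zeta as a limit of trapezoidal sums -/

/-- The `m`-th Euler-Maclaurin approximation of `(s - 1) ζ(s)`, namely `s - 1` times
`1⁻ˢ + ⋯ + (m - 1)⁻ˢ + m⁻ˢ / 2 + m¹⁻ˢ / (s - 1)`. The factor `s - 1` makes it entire. -/
noncomputable def zetaPartial (m : ℕ) (s : ℂ) : ℂ :=
  (s - 1) * (∑ k ∈ Finset.Ico 1 m, (k : ℂ) ^ (-s) + (m : ℂ) ^ (-s) / 2) + (m : ℂ) ^ (1 - s)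

theorem differentiable_zetaPartial {m : ℕ} (hm : 1 ≤ m) : Differentiable ℂ (zetaPartial m) := by
  have h : ∀ k : ℕ, 1 ≤ k → Differentiable ℂ fun s : ℂ => (k : ℂ) ^ (-s) := fun k hk =>
    (differentiable_id.neg).const_cpow (Or.inl (by exact_mod_cast (by omega : k ≠ 0)))
  unfold zetaPartial
  refine Differentiable.add (Differentiable.mul (by fun_prop) (Differentiable.add ?_ ?_)) ?_
  · exact Differentiable.fun_sum fun k hk => h k (Finset.mem_Ico.1 hk).1
  · exact (h m hm).div_const 2
  · exact ((differentiable_const 1).sub differentiable_id).const_cpow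
      (Or.inl (by exact_mod_cast (by omega : m ≠ 0)))

/-- The increments of `zetaPartial` are the trapezoidal errors of `x ↦ x⁻ˢ`, which is what makes the
sequence converge beyond `Re s > 1`, up to `Re s > -1`. -/
theorem norm_zetaPartial_sub_le {s : ℂ} {m n : ℕ} (hm : 1 ≤ m)
    (hmn : m ≤ n) :
    ‖zetaPartial n s - zetaPartial m s‖ ≤
      ‖s - 1‖ * (‖s‖ * ‖s + 1‖ / 8 * ∫ x in (m : ℝ)..n, x ^ (-s.re - 2)) := by
  -- at `s = 1` both approximations are equal to `1`
  rcases eq_or_ne s 1 with rfl | hs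
  · simp [zetaPartial]
  have hm0 : (0 : ℝ) < m := by exact_mod_cast hm
  have hpos : ∀ x ∈ Icc (m : ℝ) n, 0 < x := fun x hx => hm0.trans_le hx.1
  have hmn' : (m : ℝ) ≤ n := by exact_mod_cast hmn
  have h0 : (0 : ℝ) ∉ uIcc (m : ℝ) n := by
    rw [uIcc_of_le hmn']; exact fun h => (hpos 0 h).false
  have hI : ∫ x in (m : ℝ)..n, (x : ℂ) ^ (-s) =
      ((n : ℂ) ^ (1 - s) - (m : ℂ) ^ (1 - s)) / (1 - s) := by
    rw [integral_cpow (Or.inr ⟨by simpa using hs, h0⟩)]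
    simp only [Complex.ofReal_natCast]
    rw [show -s + 1 = 1 - s by ring]
  have hd : ∀ {r : ℂ} {x : ℝ}, 0 < x →
      HasDerivAt (fun y : ℝ => (y : ℂ) ^ r) (r * (x : ℂ) ^ (r - 1)) x := by
    intro r x hx
    rcases eq_or_ne r 0 with rfl | hr
    · simpa using hasDerivAt_const x (1 : ℂ)
    · exact hasDerivAt_ofReal_cpow_const hx.ne' hr
  have hkey := norm_sum_trapezoid_sub_integral_le (E := ℂ) (f := fun x : ℝ => (x : ℂ) ^ (-s))
    (f' := fun x : ℝ => (-s) * (x : ℂ) ^ (-s - 1))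
    (f'' := fun x : ℝ => (-s) * ((-s - 1) * (x : ℂ) ^ (-s - 1 - 1)))
    (g := fun x => ‖s‖ * ‖s + 1‖ * x ^ (-s.re - 2)) zero_le_one hmn
    (fun x hx => hd (hpos x (by simpa using hx)))
    (fun x hx => (hd (hpos x (by simpa using hx))).const_mul _) ?_ ?_ ?_
  · have hsum : ∑ k ∈ Finset.Ico m n, ((1 : ℝ) / 2) • (((k * 1 : ℝ) : ℂ) ^ (-s) +
        ((((k + 1 : ℕ) : ℝ) * 1 : ℝ) : ℂ) ^ (-s)) =
        (∑ k ∈ Finset.Ico 1 n, (k : ℂ) ^ (-s) + (n : ℂ) ^ (-s) / 2) -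
        (∑ k ∈ Finset.Ico 1 m, (k : ℂ) ^ (-s) + (m : ℂ) ^ (-s) / 2) := by
      clear hkey hI h0 hmn' hpos
      induction n, hmn using Nat.le_induction with
      | base => simp
      | succ n hn ih =>
        rw [Finset.sum_Ico_succ_top hn, ih, Finset.sum_Ico_succ_top (by omega)]
        simp
        ring
    rw [hsum] at hkey
    simp only [mul_one] at hkey
    rw [hI, intervalIntegral.integral_const_mul] at hkey
    have hs' : 1 - s ≠ 0 := sub_ne_zero.2 hs.symm
    have : zetaPartial n s - zetaPartial m s = (s - 1) *
        ((∑ k ∈ Finset.Ico 1 n, (k : ℂ) ^ (-s) + (n : ℂ) ^ (-s) / 2) -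
        (∑ k ∈ Finset.Ico 1 m, (k : ℂ) ^ (-s) + (m : ℂ) ^ (-s) / 2) -
        ((n : ℂ) ^ (1 - s) - (m : ℂ) ^ (1 - s)) / (1 - s)) := by
      unfold zetaPartial
      field_simp
      ring
    rw [this, norm_mul]
    gcongr
    calc _ ≤ _ := hkey
      _ = _ := by ring
  · refine fun x hx => ((ContinuousAt.const_mul ?_ _).const_mul _).continuousWithinAt
    exact (hd (hpos x (by simpa using hx))).continuousAt
  · simp only [mul_one]
    exact (intervalIntegral.intervalIntegrable_rpow (Or.inr h0)).const_mul _
  · intro x hx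
    have hx0 := hpos x (by simpa using hx)
    rw [norm_mul, norm_mul, Complex.norm_cpow_eq_rpow_re_of_pos hx0, norm_neg, ← norm_neg (-s - 1)]
    simp only [neg_sub, sub_neg_eq_add, Complex.sub_re, Complex.neg_re, Complex.one_re]
    rw [show -s.re - 1 - 1 = -s.re - 2 by ring, add_comm 1 s]
    exact le_of_eq (by ring)

theorem tendsto_zetaPartial_of_one_lt_re {s : ℂ} (hs : 1 < s.re) :
    Tendsto (fun m => zetaPartial m s) atTop (𝓝 (riemannZeta₁ s)) := by
  have hs1 : s ≠ 1 := by rintro rfl; simp at hs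
  have hz : ∀ r : ℂ, r.re < 0 → Tendsto (fun m : ℕ => (m : ℂ) ^ r) atTop (𝓝 0) := by
    intro r hr
    rw [tendsto_zero_iff_norm_tendsto_zero]
    have h1 := (tendsto_rpow_neg_atTop (y := -r.re) (by linarith)).comp
      (tendsto_natCast_atTop_atTop (R := ℝ))
    refine h1.congr' ?_
    filter_upwards [eventually_gt_atTop 0] with m hm
    simp [Complex.norm_natCast_cpow_of_pos hm]
  have hsum : HasSum (fun n : ℕ => ((n + 1 : ℕ) : ℂ) ^ (-s)) (riemannZeta s) := by
    have h2 := (Complex.summable_one_div_nat_cpow (p := s)).2 hs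
    have h3 := ((summable_nat_add_iff 1).2 h2).hasSum
    have h4 := zeta_eq_tsum_one_div_nat_add_one_cpow hs
    have h5 : (fun n : ℕ => 1 / ((n + 1 : ℕ) : ℂ) ^ s) = fun n : ℕ => ((n + 1 : ℕ) : ℂ) ^ (-s) := by
      funext n; rw [Complex.cpow_neg, one_div]
    rw [h5] at h3
    have h6 : riemannZeta s = ∑' n : ℕ, ((n + 1 : ℕ) : ℂ) ^ (-s) := by
      rw [h4, ← h5]; push_cast; rfl
    rwa [h6]
  have h6 : Tendsto (fun m : ℕ => ∑ k ∈ Finset.Ico 1 m, (k : ℂ) ^ (-s)) atTop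
      (𝓝 (riemannZeta s)) := by
    rw [← tendsto_add_atTop_iff_nat 1]
    refine hsum.tendsto_sum_nat.congr fun m => ?_
    rw [Finset.sum_Ico_eq_sum_range]
    simp [add_comm]
  have h7 := (((h6.add ((hz (-s) (by simp; linarith)).div_const 2)).const_mul (s - 1)).add
    (hz (1 - s) (by simp; linarith)))
  refine h7.congr' (.of_forall fun m => rfl) |>.trans (le_of_eq ?_)
  rw [riemannZeta_eq_inv_sub_mul hs1]
  congr 1
  have : s - 1 ≠ 0 := sub_ne_zero.2 hs1
  field_simp
  simp

/-- The Euler-Maclaurin approximations converge to `(s - 1) ζ(s)` on the half plane `Re s > -1`: the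
limit is analytic there and is the Dirichlet series for `Re s > 1`. -/
theorem tendsto_zetaPartial {s : ℂ} (hs : -1 < s.re) :
    Tendsto (fun m => zetaPartial m s) atTop (𝓝 (riemannZeta₁ s)) := by
  obtain ⟨δ, hδ, hδs⟩ : ∃ δ > 0, -1 + δ < s.re := ⟨(s.re + 1) / 2, by linarith, by linarith⟩
  obtain ⟨R, hR3, hRs⟩ : ∃ R : ℝ, 3 < R ∧ ‖s‖ < R :=
    ⟨max 3 ‖s‖ + 1, by linarith [le_max_left 3 ‖s‖], by linarith [le_max_right 3 ‖s‖]⟩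
  -- a bounded convex open set containing `s` and `2` on which the increments are uniformly summable
  set δ' := min δ 1 with hδ'
  have hδ'0 : 0 < δ' := lt_min hδ one_pos
  set U : Set ℂ := {z | -1 + δ' < z.re} ∩ Metric.ball 0 R with hU
  have hUo : IsOpen U := (isOpen_lt continuous_const Complex.continuous_re).inter Metric.isOpen_ball
  have hUc : IsPreconnected U :=
    ((convex_halfSpace_re_gt _).inter (convex_ball _ _)).isPreconnected
  have hsU : s ∈ U := ⟨show -1 + δ' < s.re by linarith [min_le_left δ 1], by simpa using hRs⟩
  have h2U : (2 : ℂ) ∈ U :=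
    ⟨show -1 + δ' < (2 : ℂ).re by rw [Complex.re_ofNat]; linarith [min_le_right δ 1],
    by simp; linarith⟩
  set F : ℕ → ℂ → ℂ := fun k z => zetaPartial (k + 2) z - zetaPartial (k + 1) z with hF
  set C : ℝ := (R + 1) * (R * (R + 1) / 8) with hC
  have hbound : ∀ k, ∀ z ∈ U, ‖F k z‖ ≤ C * (1 / ((k + 1 : ℕ) : ℝ) ^ (1 + δ')) := by
    intro k z hz
    have hz1 : ‖z‖ ≤ R := by simpa using (mem_ball_zero_iff.1 hz.2).le
    have hz2 : ‖z - 1‖ ≤ R + 1 := (norm_sub_le _ _).trans (by simpa using hz1)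
    have hz3 : ‖z + 1‖ ≤ R + 1 := (norm_add_le _ _).trans (by simpa using hz1)
    have hk : (1 : ℝ) ≤ (k + 1 : ℕ) := by push_cast; linarith [k.cast_nonneg (α := ℝ)]
    have h1 := norm_zetaPartial_sub_le (s := z) (m := k + 1) (n := k + 2) (by omega) (by omega)
    have hle : ((k + 1 : ℕ) : ℝ) ≤ (k + 2 : ℕ) := by push_cast; linarith
    have h2 : ∫ x in ((k + 1 : ℕ) : ℝ)..(k + 2 : ℕ), x ^ (-z.re - 2) ≤
        1 / ((k + 1 : ℕ) : ℝ) ^ (1 + δ') := by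
      have h3 := intervalIntegral.integral_mono_on (μ := volume) hle
        (f := fun x => x ^ (-z.re - 2)) (g := fun _ => 1 / ((k + 1 : ℕ) : ℝ) ^ (1 + δ')) ?_ ?_ ?_
      · refine h3.trans (le_of_eq ?_)
        rw [intervalIntegral.integral_const, smul_eq_mul]
        push_cast; ring
      · refine intervalIntegral.intervalIntegrable_rpow (Or.inr ?_)
        rw [uIcc_of_le hle]; intro h; linarith [h.1]
      · exact intervalIntegrable_const
      · intro x hx
        rw [one_div, ← Real.rpow_neg (by positivity)]
        have hre : -1 + δ' < z.re := hz.1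
        calc x ^ (-z.re - 2) ≤ x ^ (-(1 + δ')) :=
              Real.rpow_le_rpow_of_exponent_le (hk.trans hx.1) (by linarith)
          _ ≤ _ := Real.rpow_le_rpow_of_nonpos (by linarith) hx.1 (by linarith)
    have h4 : 0 ≤ ∫ x in ((k + 1 : ℕ) : ℝ)..(k + 2 : ℕ), x ^ (-z.re - 2) :=
      intervalIntegral.integral_nonneg hle fun x hx => Real.rpow_nonneg (by linarith [hx.1]) _
    calc ‖F k z‖ ≤ _ := h1
      _ ≤ (R + 1) * (R * (R + 1) / 8 * (1 / ((k + 1 : ℕ) : ℝ) ^ (1 + δ'))) := by gcongr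
      _ = _ := by rw [hC]; ring
  have hsumm : Summable fun k : ℕ => C * (1 / ((k + 1 : ℕ) : ℝ) ^ (1 + δ')) :=
    ((summable_nat_add_iff 1).2 (Real.summable_one_div_nat_rpow.2 (by linarith))).mul_left C
  set Z : ℂ → ℂ := fun z => zetaPartial 1 z + ∑' k, F k z with hZ
  have hZd : DifferentiableOn ℂ Z U := by
    refine (differentiable_zetaPartial le_rfl).differentiableOn.add ?_
    refine Complex.differentiableOn_tsum_of_summable_norm hsumm (fun k => ?_) hUo hbound
    exact ((differentiable_zetaPartial (by omega)).sub
      (differentiable_zetaPartial (by omega))).differentiableOn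
  have hlim : ∀ z ∈ U, Tendsto (fun m => zetaPartial m z) atTop (𝓝 (Z z)) := by
    intro z hz
    have h1 := (Summable.of_norm_bounded hsumm fun k => hbound k z hz).hasSum.tendsto_sum_nat
    rw [← tendsto_add_atTop_iff_nat 1]
    refine (h1.const_add (zetaPartial 1 z)).congr fun m => ?_
    have := Finset.sum_range_sub (fun k => zetaPartial (k + 1) z) m
    simp only [hF]
    rw [this]
    simp
  have heq : EqOn Z riemannZeta₁ U := by
    refine (hZd.analyticOnNhd hUo).eqOn_of_preconnected_of_eventuallyEq
      (differentiable_riemannZeta₁.differentiableOn.analyticOnNhd hUo) hUc h2U ?_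
    filter_upwards [hUo.mem_nhds h2U,
      (isOpen_lt continuous_const Complex.continuous_re).mem_nhds
        (show (1 : ℝ) < (2 : ℂ).re by simp)] with z hz hz1
    exact tendsto_nhds_unique (hlim z hz) (tendsto_zetaPartial_of_one_lt_re hz1)
  rw [← heq hsU]
  exact hlim s hsU

/-- The error `∑'' k^(1-α) - ∫₀ᵐ y^(1-α) dy` of the trapezoidal rule with unit steps on `[0, m]`,
the term `k = 0` being dropped and the term `k = m` halved. -/
noncomputable def powerTrapezoid (α : ℝ) (m : ℕ) : ℝ :=
  ∑ k ∈ Finset.Ico 1 m, (k : ℝ) ^ (1 - α) + (m : ℝ) ^ (1 - α) / 2 - (m : ℝ) ^ (2 - α) / (2 - α)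

theorem zetaPartial_eq_powerTrapezoid {α : ℝ} (hα : α < 2) (m : ℕ) :
    zetaPartial m ((α : ℂ) - 1) = (((α - 2) * powerTrapezoid α m : ℝ) : ℂ) := by
  have hc : ∀ (k : ℕ) (r : ℝ), (((k : ℝ) ^ r : ℝ) : ℂ) = (k : ℂ) ^ (r : ℂ) := fun k r => by
    rw [Complex.ofReal_cpow k.cast_nonneg]; simp
  have h2 : (2 : ℂ) - α ≠ 0 := by
    have : ((2 - α : ℝ) : ℂ) ≠ 0 := Complex.ofReal_ne_zero.2 (by linarith)
    simpa using this
  unfold zetaPartial powerTrapezoid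
  push_cast [hc]
  rw [show -((α : ℂ) - 1) = 1 - α by ring, show (1 : ℂ) - (α - 1) = 2 - α by ring]
  field_simp
  ring

theorem re_riemannZeta₁_sub_one {α : ℝ} (hα : α < 2) :
    (riemannZeta₁ ((α : ℂ) - 1)).re = (α - 2) * zetaConst α := by
  have h2 : (α : ℂ) - 2 ≠ 0 := by
    have : ((α - 2 : ℝ) : ℂ) ≠ 0 := Complex.ofReal_ne_zero.2 (by linarith)
    simpa using this
  have h1 : (α : ℂ) - 1 ≠ 1 := fun h => h2 (by linear_combination h)
  have h3 : riemannZeta₁ ((α : ℂ) - 1) = ((α - 2 : ℝ) : ℂ) * riemannZeta ((α : ℂ) - 1) := by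
    rw [riemannZeta_eq_inv_sub_mul h1, show (α : ℂ) - 1 - 1 = α - 2 by ring]
    push_cast
    field_simp
  rw [h3, Complex.re_ofReal_mul, zetaConst]

theorem tendsto_powerTrapezoid {α : ℝ} (hα₀ : 0 < α) (hα₂ : α < 2) :
    Tendsto (powerTrapezoid α) atTop (𝓝 (zetaConst α)) := by
  have h := tendsto_zetaPartial (s := (α : ℂ) - 1) (by simpa using hα₀)
  have h' := (Complex.continuous_re.tendsto _).comp h
  rw [re_riemannZeta₁_sub_one hα₂] at h'
  have h2 : α - 2 ≠ 0 := by linarith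
  have h3 := h'.const_mul (α - 2)⁻¹
  rw [inv_mul_cancel_left₀ h2] at h3
  refine h3.congr fun m => ?_
  simp only [Function.comp, zetaPartial_eq_powerTrapezoid hα₂, Complex.ofReal_re]
  rw [inv_mul_cancel_left₀ h2]

/-- The trapezoidal rule for `y^(1-α)` has the error `ζ(α-1)`, up to `m^(-α)`. This is why the
scheme carries the correction term with the factor `ζ(α-1)`. -/
theorem abs_powerTrapezoid_sub_le {α : ℝ} (hα₀ : 0 < α) (hα₂ : α < 2) {m : ℕ} (hm : 1 ≤ m) :
    |powerTrapezoid α m - zetaConst α| ≤ (m : ℝ) ^ (-α) := by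
  have hm0 : (0 : ℝ) < m := by exact_mod_cast hm
  refine le_of_tendsto ((tendsto_const_nhds.sub (tendsto_powerTrapezoid hα₀ hα₂)).abs) ?_
  filter_upwards [eventually_ge_atTop m] with n hn
  have hmn : (m : ℝ) ≤ n := by exact_mod_cast hn
  have h := norm_zetaPartial_sub_le (s := (α : ℂ) - 1) hm hn
  rw [zetaPartial_eq_powerTrapezoid hα₂, zetaPartial_eq_powerTrapezoid hα₂, ← Complex.ofReal_sub,
    ← mul_sub, Complex.norm_real, norm_mul, Real.norm_eq_abs, Real.norm_eq_abs,
    show (α : ℂ) - 1 - 1 = ((α - 2 : ℝ) : ℂ) by push_cast; ring,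
    show (α : ℂ) - 1 + 1 = (α : ℂ) by ring, show (α : ℂ) - 1 = ((α - 1 : ℝ) : ℂ) by push_cast; ring,
    Complex.norm_real, Complex.norm_real, Complex.norm_real, Complex.ofReal_re,
    integral_rpow (Or.inr ⟨by intro h; linarith, by
      rw [uIcc_of_le hmn]; intro h; linarith [h.1]⟩),
    show -(α - 1) - 2 + 1 = -α by ring, Real.norm_eq_abs, Real.norm_eq_abs, Real.norm_eq_abs,
    abs_of_pos hα₀] at h
  have h2 : 0 < |α - 2| := abs_pos.2 (by linarith)
  have h3 := le_of_mul_le_mul_left h h2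
  rw [abs_sub_comm]
  have h4 : |α - 1| ≤ 1 := abs_le.2 ⟨by linarith, by linarith⟩
  have h5 : 0 ≤ (n : ℝ) ^ (-α) := Real.rpow_nonneg n.cast_nonneg _
  have h6 : (n : ℝ) ^ (-α) ≤ (m : ℝ) ^ (-α) := Real.rpow_le_rpow_of_nonpos hm0 hmn (by linarith)
  calc _ ≤ _ := h3
    _ = |α - 1| * (((m : ℝ) ^ (-α) - (n : ℝ) ^ (-α)) / 8) := by field_simp; ring
    _ ≤ 1 * (((m : ℝ) ^ (-α) - (n : ℝ) ^ (-α)) / 8) := by gcongr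
    _ ≤ _ := by linarith

/-- For `α ≤ 1` the function `y^(1-α)` is concave, so that the trapezoidal rule underestimates its
integral; for `α ≥ 1` it is decreasing, and the sum is below the integral even without halving the
last term. -/
theorem powerTrapezoid_nonpos {α : ℝ} (hα₀ : 0 < α) (hα₂ : α < 2) {m : ℕ} (hm : 1 ≤ m) :
    powerTrapezoid α m ≤ 0 := by
  have hint : ∀ k : ℕ, 1 ≤ k → ∫ x in (k : ℝ)..(k + 1 : ℕ), x ^ (1 - α) =
      ((k + 1 : ℕ) : ℝ) ^ (2 - α) / (2 - α) - (k : ℝ) ^ (2 - α) / (2 - α) := by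
    intro k hk
    rw [integral_rpow (Or.inl (by linarith)), show 1 - α + 1 = 2 - α by ring, sub_div]
  rcases le_total α 1 with h1 | h1
  · induction m, hm using Nat.le_induction with
    | base =>
      have : 1 / 2 ≤ 1 / (2 - α) := one_div_le_one_div_of_le (by linarith) (by linarith)
      simp [powerTrapezoid] at this ⊢
      linarith
    | succ k hk ih =>
      have hk0 : (0 : ℝ) < k := by exact_mod_cast hk
      have hle : (k : ℝ) ≤ (k + 1 : ℕ) := by push_cast; linarith
      have hpos : ∀ x ∈ uIcc (k : ℝ) (k + 1 : ℕ), 0 < x := by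
        intro x hx; rw [uIcc_of_le hle] at hx; linarith [hx.1]
      have ht := trapezoid_sub_integral (E := ℝ) (a := k) (b := (k + 1 : ℕ))
        (f := fun x => x ^ (1 - α)) (f' := fun x => (1 - α) * x ^ (1 - α - 1))
        (f'' := fun x => (1 - α) * ((1 - α - 1) * x ^ (1 - α - 1 - 1)))
        (fun x hx => Real.hasDerivAt_rpow_const (Or.inl (hpos x hx).ne'))
        (fun x hx => (Real.hasDerivAt_rpow_const (Or.inl (hpos x hx).ne')).const_mul _)
        (fun x hx => ((Real.continuousAt_rpow_const _ _ (Or.inl (hpos x hx).ne')).const_mul _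
          |>.const_mul _).continuousWithinAt)
      have hneg : ∫ x in (k : ℝ)..(k + 1 : ℕ), ((x - k) * ((k + 1 : ℕ) - x) / 2) •
          ((1 - α) * ((1 - α - 1) * x ^ (1 - α - 1 - 1))) ≤ 0 := by
        rw [← neg_nonneg, ← intervalIntegral.integral_neg]
        refine intervalIntegral.integral_nonneg hle fun x hx => ?_
        have hx0 : 0 ≤ x ^ (1 - α - 1 - 1) := Real.rpow_nonneg (by linarith [hx.1]) _
        have h2 : 0 ≤ (x - k) * ((k + 1 : ℕ) - x) :=
          mul_nonneg (by linarith [hx.1]) (by linarith [hx.2])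
        have h3 : 0 ≤ (1 - α) * α := mul_nonneg (by linarith) hα₀.le
        rw [smul_eq_mul]
        have := mul_nonneg (mul_nonneg h2 h3) hx0
        linarith
      rw [← ht, hint k hk, smul_eq_mul] at hneg
      unfold powerTrapezoid at ih ⊢
      rw [Finset.sum_Ico_succ_top hk]
      push_cast at hneg ⊢
      linarith
  · have h2 : 0 < 2 - α := by linarith
    have hone : 1 ≤ 1 / (2 - α) := by rw [le_div_iff₀ h2]; linarith
    have hsum : ∀ m : ℕ, 1 ≤ m →
        ∑ k ∈ Finset.Ico 1 m, (k : ℝ) ^ (1 - α) + (m : ℝ) ^ (1 - α) ≤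
          (m : ℝ) ^ (2 - α) / (2 - α) := by
      intro m hm
      induction m, hm using Nat.le_induction with
      | base => simpa using hone
      | succ k hk ih =>
        have hk0 : (0 : ℝ) < k := by exact_mod_cast hk
        have hle : (k : ℝ) ≤ (k + 1 : ℕ) := by push_cast; linarith
        have := intervalIntegral.integral_mono_on (μ := volume) hle
          (f := fun _ => ((k + 1 : ℕ) : ℝ) ^ (1 - α)) (g := fun x => x ^ (1 - α))
          intervalIntegrable_const (intervalIntegral.intervalIntegrable_rpow' (by linarith))
          (fun x hx => Real.rpow_le_rpow_of_nonpos (by linarith [hx.1]) hx.2 (by linarith))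
        rw [hint k hk, intervalIntegral.integral_const, smul_eq_mul] at this
        rw [Finset.sum_Ico_succ_top hk]
        push_cast at this ⊢
        linarith
    have := hsum m hm
    have h3 : 0 ≤ (m : ℝ) ^ (1 - α) := Real.rpow_nonneg m.cast_nonneg _
    unfold powerTrapezoid
    linarith

theorem zetaConst_nonpos {α : ℝ} (hα₀ : 0 < α) (hα₂ : α < 2) : zetaConst α ≤ 0 :=
  le_of_tendsto (tendsto_powerTrapezoid hα₀ hα₂)
    ((eventually_ge_atTop 1).mono fun _ hm => powerTrapezoid_nonpos hα₀ hα₂ hm)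

theorem sum_rpow_one_sub_le {α : ℝ} (hα₀ : 0 < α) (hα₂ : α < 2) {m : ℕ} (hm : 1 ≤ m) :
    ∑ k ∈ Finset.Ico 1 m, (k : ℝ) ^ (1 - α) ≤ (m : ℝ) ^ (2 - α) / (2 - α) := by
  have h := powerTrapezoid_nonpos hα₀ hα₂ hm
  have h3 : 0 ≤ (m : ℝ) ^ (1 - α) := Real.rpow_nonneg m.cast_nonneg _
  unfold powerTrapezoid at h
  linarith

theorem sum_rpow_neg_le {α : ℝ} (hα₀ : 0 < α) {m n : ℕ} (hm : 1 ≤ m) :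
    ∑ k ∈ Finset.Icc m n, (k : ℝ) ^ (-(1 + α)) ≤ (1 + 1 / α) * (m : ℝ) ^ (-α) := by
  have hm0 : (0 : ℝ) < m := by exact_mod_cast hm
  have hfirst : (m : ℝ) ^ (-(1 + α)) ≤ (m : ℝ) ^ (-α) :=
    Real.rpow_le_rpow_of_exponent_le (by exact_mod_cast hm) (by linarith)
  rcases lt_or_ge n m with h | h
  · rw [Finset.Icc_eq_empty (by omega)]
    simp only [Finset.sum_empty]; positivity
  have hstrong : ∑ k ∈ Finset.Icc m n, (k : ℝ) ^ (-(1 + α)) ≤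
      (m : ℝ) ^ (-α) + 1 / α * ((m : ℝ) ^ (-α) - (n : ℝ) ^ (-α)) := by
    induction n, h using Nat.le_induction with
    | base => simpa using hfirst
    | succ k hk ih =>
      have hk0 : (0 : ℝ) < k := by exact_mod_cast (hm.trans hk)
      have hle : (k : ℝ) ≤ (k + 1 : ℕ) := by push_cast; linarith
      have h0 : (0 : ℝ) ∉ uIcc (k : ℝ) (k + 1 : ℕ) := by
        rw [uIcc_of_le hle]; intro h; linarith [h.1]
      have := intervalIntegral.integral_mono_on (μ := volume) hle
        (f := fun _ => ((k + 1 : ℕ) : ℝ) ^ (-(1 + α))) (g := fun x => x ^ (-(1 + α)))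
        intervalIntegrable_const (intervalIntegral.intervalIntegrable_rpow (Or.inr h0))
        (fun x hx => Real.rpow_le_rpow_of_nonpos (by linarith [hx.1]) hx.2 (by linarith))
      rw [integral_rpow (Or.inr ⟨by intro h; linarith, h0⟩), intervalIntegral.integral_const,
        smul_eq_mul, show -(1 + α) + 1 = -α by ring, div_neg, ← neg_div] at this
      rw [Finset.sum_Icc_succ_top (by omega)]
      have e : -(((k + 1 : ℕ) : ℝ) ^ (-α) - (k : ℝ) ^ (-α)) / α =
        1 / α * (k : ℝ) ^ (-α) - 1 / α * ((k + 1 : ℕ) : ℝ) ^ (-α) := by ring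
      rw [e] at this
      push_cast at this ih ⊢
      linarith
  have h5 : 0 ≤ 1 / α * (n : ℝ) ^ (-α) := by positivity
  linarith

/-! ### Monotonicity of the Euler step and the discrete maximum principle -/

theorem levyConst_pos {α : ℝ} (hα₀ : 0 < α) (hα₂ : α < 2) : 0 < levyConst α := by
  have h1 := Real.Gamma_pos_of_pos (show 0 < (1 + α) / 2 by linarith)
  have h2 := Real.Gamma_pos_of_pos (show 0 < 1 - α / 2 by linarith)
  have h3 := Real.pi_pos
  unfold levyConst
  positivity

theorem sum_abs_rpow_neg_le {α : ℝ} (hα₀ : 0 < α) {m : ℕ} (hm : 1 ≤ m) (s : Finset ℤ)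
    (hs : ∀ k ∈ s, (m : ℤ) ≤ |k|) :
    ∑ k ∈ s, |(k : ℝ)| ^ (-(1 + α)) ≤ 2 * ((1 + 1 / α) * (m : ℝ) ^ (-α)) := by
  have hmaps : ∀ k ∈ s, k.natAbs ∈ Finset.Icc m (s.sup Int.natAbs) := fun k hk =>
    Finset.mem_Icc.2 ⟨by have := hs k hk; rw [Int.abs_eq_natAbs] at this; omega,
      Finset.le_sup (f := Int.natAbs) hk⟩
  rw [← Finset.sum_fiberwise_of_maps_to hmaps]
  refine le_trans ?_ (mul_le_mul_of_nonneg_left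
    (sum_rpow_neg_le hα₀ (n := s.sup Int.natAbs) hm) zero_le_two)
  rw [Finset.mul_sum]
  refine Finset.sum_le_sum fun n _ => ?_
  have hcard : ({k ∈ s | k.natAbs = n} : Finset ℤ).card ≤ 2 := by
    refine (Finset.card_le_card (t := {(n : ℤ), -(n : ℤ)}) fun k hk => ?_).trans
      Finset.card_le_two
    have := (Finset.mem_filter.1 hk).2
    simp only [Finset.mem_insert, Finset.mem_singleton]
    omega
  have hval : ∀ k ∈ ({k ∈ s | k.natAbs = n} : Finset ℤ),
      |(k : ℝ)| ^ (-(1 + α)) = (n : ℝ) ^ (-(1 + α)) := by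
    intro k hk
    rw [← (Finset.mem_filter.1 hk).2, Nat.cast_natAbs, Int.cast_abs]
  rw [Finset.sum_congr rfl hval, Finset.sum_const, nsmul_eq_mul]
  refine mul_le_mul_of_nonneg_right (by exact_mod_cast hcard) (by positivity)

theorem mul_sum_inv_abs_mul_rpow_le {α h : ℝ} (hα₀ : 0 < α) (hh : 0 < h) {m : ℕ} (hm : 1 ≤ m)
    (s : Finset ℤ) (hs : ∀ k ∈ s, (m : ℤ) ≤ |k|) :
    h * ∑ k ∈ s, (|(k : ℝ) * h| ^ (1 + α))⁻¹ ≤ 2 * ((1 + 1 / α) * (m * h) ^ (-α)) := by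
  have h1 : ∀ k ∈ s, (|(k : ℝ) * h| ^ (1 + α))⁻¹ = h ^ (-(1 + α)) * |(k : ℝ)| ^ (-(1 + α)) := by
    intro k _
    rw [abs_mul, abs_of_pos hh, Real.mul_rpow (abs_nonneg _) hh.le, mul_inv,
      Real.rpow_neg hh.le, Real.rpow_neg (abs_nonneg _), mul_comm]
  have h2 : h * h ^ (-(1 + α)) = h ^ (-α) := by
    rw [← Real.rpow_one_add' hh.le (by linarith)]; congr 1; ring
  rw [Finset.sum_congr rfl h1, ← Finset.mul_sum, ← mul_assoc, h2,
    Real.mul_rpow m.cast_nonneg hh.le]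
  calc _ ≤ h ^ (-α) * (2 * ((1 + 1 / α) * (m : ℝ) ^ (-α))) := by
        gcongr; exact sum_abs_rpow_neg_le hα₀ hm s hs
    _ = _ := by ring

/-- The weight of the index `k` in `trapezoidSum`: `1 / 2` at the two ends of the range, `1`
inside. -/
noncomputable def trapezoidWeight (J : ℕ) (j k : ℤ) : ℝ :=
  if k = -(J : ℤ) - j ∨ k = (J : ℤ) - j then 1 / 2 else 1

theorem trapezoidWeight_nonneg (J : ℕ) (j k : ℤ) : 0 ≤ trapezoidWeight J j k := by
  unfold trapezoidWeight; split_ifs <;> norm_num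

theorem trapezoidWeight_le_one (J : ℕ) (j k : ℤ) : trapezoidWeight J j k ≤ 1 := by
  unfold trapezoidWeight; split_ifs <;> norm_num

theorem trapezoidSum_eq (α h : ℝ) (J : ℕ) (V : ℤ → ℝ) (j : ℤ) :
    trapezoidSum α h J V j = ∑ k ∈ (Finset.Icc (-(J : ℤ) - j) ((J : ℤ) - j)).erase 0,
      trapezoidWeight J j k * ((V (j + k) - V j) / |(k : ℝ) * h| ^ (1 + α)) := rfl

theorem trapezoidSum_lin (α h a b : ℝ) (J : ℕ) (V W : ℤ → ℝ) (j : ℤ) :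
    trapezoidSum α h J (fun i => a * V i + b * W i) j =
      a * trapezoidSum α h J V j + b * trapezoidSum α h J W j := by
  simp only [trapezoidSum_eq, Finset.mul_sum, ← Finset.sum_add_distrib]
  exact Finset.sum_congr rfl fun k _ => by ring

theorem eulerStep_lin (α ε h Δt a b : ℝ) (J : ℕ) (V W : ℤ → ℝ) (j : ℤ) :
    eulerStep α ε h Δt J (fun i => a * V i + b * W i) j =
      a * eulerStep α ε h Δt J V j + b * eulerStep α ε h Δt J W j := by
  unfold eulerStep
  rw [trapezoidSum_lin]
  ring

theorem eulerStep_const (α ε h Δt a : ℝ) (J : ℕ) (j : ℤ) :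
    eulerStep α ε h Δt J (fun _ => a) j = a := by
  simp only [eulerStep, trapezoidSum, sub_self, zero_div, mul_zero, Finset.sum_const_zero]
  ring

/-- Under the step condition all coefficients of the Euler step are nonnegative: those of the
neighbours because `ζ(α-1) ≤ 0`, that of `V j` because `∑ |k|^(-1-α) ≤ 2 (1 + 1/α)`. -/
theorem eulerStep_nonneg {α ε h Δt : ℝ} {J : ℕ} {V : ℤ → ℝ} {j : ℤ}
    (hα₀ : 0 < α) (hα₂ : α < 2) (hε : 0 < ε) (hh : 0 < h) (hΔ : 0 < Δt)
    (hstep : StepCondition α ε h Δt) (hV : ∀ i : ℤ, |i| ≤ J → 0 ≤ V i) (hj : |j| < J) :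
    0 ≤ eulerStep α ε h Δt J V j := by
  have hc := levyConst_pos hα₀ hα₂
  have hζ := zetaConst_nonpos hα₀ hα₂
  rw [abs_lt] at hj
  set s := (Finset.Icc (-(J : ℤ) - j) ((J : ℤ) - j)).erase 0 with hs
  have hsum1 : h * ∑ k ∈ s, (|(k : ℝ) * h| ^ (1 + α))⁻¹ ≤ 2 * ((1 + 1 / α) * h ^ (-α)) := by
    have := mul_sum_inv_abs_mul_rpow_le hα₀ hh le_rfl s fun k hk => by
      have := Finset.ne_of_mem_erase hk
      have := abs_pos.2 this
      push_cast; omega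
    simpa using this
  have hV0 : 0 ≤ V j := hV j (abs_le.2 ⟨by omega, by omega⟩)
  have hterm : -(V j * ∑ k ∈ s, (|(k : ℝ) * h| ^ (1 + α))⁻¹) ≤ trapezoidSum α h J V j := by
    rw [trapezoidSum_eq, Finset.mul_sum, ← Finset.sum_neg_distrib]
    refine Finset.sum_le_sum fun k hk => ?_
    have hk' := Finset.mem_Icc.1 (Finset.mem_of_mem_erase hk)
    have hVk : 0 ≤ V (j + k) := hV _ (abs_le.2 ⟨by omega, by omega⟩)
    have hw0 := trapezoidWeight_nonneg J j k
    have hw1 := trapezoidWeight_le_one J j k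
    have hd : 0 ≤ (|(k : ℝ) * h| ^ (1 + α))⁻¹ := by positivity
    rw [div_eq_mul_inv]
    have h1 : 0 ≤ trapezoidWeight J j k * (V (j + k) * (|(k : ℝ) * h| ^ (1 + α))⁻¹) := by positivity
    have h2 : 0 ≤ (1 - trapezoidWeight J j k) * (V j * (|(k : ℝ) * h| ^ (1 + α))⁻¹) :=
      mul_nonneg (by linarith) (by positivity)
    linarith
  have hcfl : Δt * ε * levyConst α * (2 * (1 + 1 / α - zetaConst α)) * h ^ (-α) ≤ 1 := by
    have h1 : 0 < 1 + 1 / α - zetaConst α := by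
      have : 0 < 1 / α := by positivity
      linarith
    have h2 : 0 < 2 * ε * levyConst α * (1 + 1 / α - zetaConst α) := by positivity
    have h3 := (le_div_iff₀ h2).1 hstep
    rw [Real.rpow_neg hh.le]
    calc _ = Δt / h ^ α * (2 * ε * levyConst α * (1 + 1 / α - zetaConst α)) := by
          rw [div_eq_mul_inv]; ring
      _ ≤ 1 := h3
  have hn1 : 0 ≤ V (j - 1) := hV _ (abs_le.2 ⟨by omega, by omega⟩)
  have hp1 : 0 ≤ V (j + 1) := hV _ (abs_le.2 ⟨by omega, by omega⟩)
  have hcpos : 0 < Δt * ε * levyConst α := by positivity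
  have hhα : 0 < h ^ (-α) := by positivity
  unfold eulerStep
  set c := Δt * ε * levyConst α with hcdef
  have a1 : 0 ≤ c * (-zetaConst α) * h ^ (-α) * (V (j - 1) + V (j + 1)) :=
    mul_nonneg (mul_nonneg (mul_nonneg hcpos.le (by linarith)) hhα.le) (by linarith)
  have a2 := mul_le_mul_of_nonneg_left hterm (mul_pos hcpos hh).le
  have a3 := mul_le_mul_of_nonneg_left hsum1 (mul_nonneg hcpos.le hV0)
  have a4 := mul_le_mul_of_nonneg_right hcfl hV0
  nlinarith

theorem eulerStep_mono {α ε h Δt : ℝ} {J : ℕ} {V W : ℤ → ℝ} {j : ℤ}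
    (hα₀ : 0 < α) (hα₂ : α < 2) (hε : 0 < ε) (hh : 0 < h) (hΔ : 0 < Δt)
    (hstep : StepCondition α ε h Δt) (hVW : ∀ i : ℤ, |i| ≤ J → V i ≤ W i) (hj : |j| < J) :
    eulerStep α ε h Δt J V j ≤ eulerStep α ε h Δt J W j := by
  have := eulerStep_nonneg (V := fun i => 1 * W i + (-1) * V i) hα₀ hα₂ hε hh hΔ hstep
    (fun i hi => by linarith [hVW i hi]) hj
  rw [eulerStep_lin] at this
  linarith

theorem abs_eulerStep_le {α ε h Δt : ℝ} {J : ℕ} {V W : ℤ → ℝ} {j : ℤ}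
    (hα₀ : 0 < α) (hα₂ : α < 2) (hε : 0 < ε) (hh : 0 < h) (hΔ : 0 < Δt)
    (hstep : StepCondition α ε h Δt) (hVW : ∀ i : ℤ, |i| ≤ J → |V i| ≤ W i) (hj : |j| < J) :
    |eulerStep α ε h Δt J V j| ≤ eulerStep α ε h Δt J W j := by
  refine abs_le.2 ⟨?_, eulerStep_mono hα₀ hα₂ hε hh hΔ hstep
    (fun i hi => (le_abs_self _).trans (hVW i hi)) hj⟩
  have := eulerStep_mono (V := fun i => (-1) * W i + 0 * W i) (W := V) hα₀ hα₂ hε hh hΔ hstep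
    (fun i hi => by linarith [neg_abs_le (V i), hVW i hi]) hj
  rw [eulerStep_lin] at this
  linarith

theorem gridError_succ {α ε h Δt M : ℝ} {J : ℕ} {p : ℝ → ℝ → ℝ} {U : ℕ → ℤ → ℝ}
    (hΔ : 0 < Δt) (hU : IsNumericalSolution α ε h Δt M J p U) (n : ℕ) {j : ℤ} (hj : |j| < J) :
    gridError h Δt p U (n + 1) j =
      eulerStep α ε h Δt J (gridError h Δt p U n) j - Δt * truncationError α ε h Δt J p n j := by
  have h1 : gridError h Δt p U n = fun i => 1 * U n i + (-1) * p (i * h) (n * Δt) := by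
    funext i; simp only [gridError]; ring
  rw [h1, eulerStep_lin, truncationError, mul_div_cancel₀ _ hΔ.ne', gridError, hU.step n j hj]
  push_cast
  ring

theorem gridError_zero {α ε h Δt M : ℝ} {J : ℕ} {p : ℝ → ℝ → ℝ} {U : ℕ → ℤ → ℝ}
    (hU : IsNumericalSolution α ε h Δt M J p U) {j : ℤ} (hj : |j| < J) :
    gridError h Δt p U 0 j = 0 := by
  simp [gridError, hU.initial j hj]

theorem abs_gridError_le_of_truncationError_le {α ε h Δt M : ℝ} {J : ℕ} {p : ℝ → ℝ → ℝ}
    {U : ℕ → ℤ → ℝ} (hα₀ : 0 < α) (hα₂ : α < 2) (hε : 0 < ε) (hh : 0 < h) (hJ : 0 < J)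
    (hΔ : 0 < Δt) (hstep : StepCondition α ε h Δt)
    (hU : IsNumericalSolution α ε h Δt M J p U) {n : ℕ} {τ β : ℝ}
    (hτ : ∀ m < n, ∀ j : ℤ, |j| < (J : ℤ) → |truncationError α ε h Δt J p m j| ≤ τ)
    (hβ : ∀ m ≤ n, ∀ j : ℤ, |j| = (J : ℤ) → |gridError h Δt p U m j| ≤ β)
    {j : ℤ} (hj : |j| ≤ (J : ℤ)) : |gridError h Δt p U n j| ≤ β + n * Δt * τ := by
  have hβ0 : 0 ≤ β := (abs_nonneg _).trans (hβ 0 (Nat.zero_le _) J (by simp))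
  induction n generalizing j with
  | zero =>
    rcases hj.lt_or_eq with hj | hj
    · simpa [gridError_zero hU hj] using hβ0
    · simpa using hβ 0 le_rfl j hj
  | succ n ih =>
    have hτ0 : 0 ≤ τ := (abs_nonneg _).trans (hτ 0 (Nat.succ_pos _) 0 (by simpa using hJ))
    rcases hj.lt_or_eq with hj | hj
    · rw [gridError_succ hΔ hU n hj]
      have h1 := abs_eulerStep_le (V := gridError h Δt p U n) (W := fun _ => β + n * Δt * τ)
        hα₀ hα₂ hε hh hΔ hstep
        (fun i hi => ih (fun m hm => hτ m (hm.trans n.lt_succ_self))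
          (fun m hm => hβ m (hm.trans n.le_succ)) hi) hj
      rw [eulerStep_const] at h1
      have h2 := hτ n n.lt_succ_self j hj
      have h3 : |Δt * truncationError α ε h Δt J p n j| ≤ Δt * τ := by
        rw [abs_mul, abs_of_pos hΔ]; gcongr
      have h4 := abs_sub (eulerStep α ε h Δt J (gridError h Δt p U n) j)
        (Δt * truncationError α ε h Δt J p n j)
      push_cast
      linarith
    · refine (hβ _ le_rfl j hj).trans (le_add_of_nonneg_right (by positivity))

/-- The sum over the asymmetric range `-J-j ≤ k ≤ J-j` equals the sum of symmetric second
differences over `|k| < m`, where `m = J - |j|` is the distance to the nearer end, up to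
`O((m h)^(-α))` times the oscillation of `V`. -/
theorem abs_trapezoidSum_sub_le {α h B : ℝ} {J m : ℕ} {V : ℤ → ℝ} {j : ℤ} (hα₀ : 0 < α)
    (hh : 0 < h) (hm : 1 ≤ m) (hmj : (m : ℤ) = J - |j|)
    (hV : ∀ i : ℤ, |i| ≤ J → |V i - V j| ≤ B) :
    |h * trapezoidSum α h J V j -
      h * ∑ k ∈ Finset.Ico 1 m, (V (j + k) + V (j - k) - 2 * V j) / ((k : ℝ) * h) ^ (1 + α)| ≤
      B * (2 * ((1 + 1 / α) * (m * h) ^ (-α))) := by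
  have hj1 := le_abs_self j
  have hj2 := neg_abs_le j
  set s := (Finset.Icc (-(J : ℤ) - j) ((J : ℤ) - j)).erase 0 with hs
  have hB : 0 ≤ B := (abs_nonneg _).trans (hV j (by omega))
  set F : ℤ → ℝ := fun k => (V (j + k) - V j) / |(k : ℝ) * h| ^ (1 + α) with hF
  -- all indices `|k| < m` are interior, so that they have weight one and pair up
  have hnear : ∑ k ∈ s with |k| < (m : ℤ), trapezoidWeight J j k * F k =
      ∑ k ∈ Finset.Ico 1 m, (V (j + k) + V (j - k) - 2 * V j) / ((k : ℝ) * h) ^ (1 + α) := by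
    have hset : ({k ∈ s | |k| < m} : Finset ℤ) =
        (Finset.Ico 1 m).image (fun k : ℕ => (k : ℤ)) ∪
          (Finset.Ico 1 m).image (fun k : ℕ => -(k : ℤ)) := by
      ext k
      simp only [hs, Finset.mem_filter, Finset.mem_erase, Finset.mem_Icc, Finset.mem_union,
        Finset.mem_image, Finset.mem_Ico, abs_lt]
      constructor
      · rintro ⟨⟨h0, _, _⟩, h3, h4⟩
        rcases lt_or_gt_of_ne h0 with h | h
        · exact Or.inr ⟨k.natAbs, by omega, by omega⟩
        · exact Or.inl ⟨k.natAbs, by omega, by omega⟩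
      · rintro (⟨n, hn, rfl⟩ | ⟨n, hn, rfl⟩) <;> omega
    have hdisj : Disjoint ((Finset.Ico 1 m).image (fun k : ℕ => (k : ℤ)))
        ((Finset.Ico 1 m).image (fun k : ℕ => -(k : ℤ))) := by
      rw [Finset.disjoint_left]
      intro k hk hk'
      simp only [Finset.mem_image, Finset.mem_Ico] at hk hk'
      obtain ⟨a, ha, rfl⟩ := hk
      obtain ⟨b, hb, hab⟩ := hk'
      omega
    rw [hset, Finset.sum_union hdisj, Finset.sum_image (fun a _ b _ hab => by simpa using hab),
      Finset.sum_image (fun a _ b _ hab => by simpa using hab), ← Finset.sum_add_distrib]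
    refine Finset.sum_congr rfl fun k hk => ?_
    rw [Finset.mem_Ico] at hk
    have hw1 : trapezoidWeight J j k = 1 := if_neg (by omega)
    have hw2 : trapezoidWeight J j (-k) = 1 := if_neg (by omega)
    have hkh : 0 ≤ (k : ℝ) * h := by positivity
    rw [hw1, hw2]
    simp only [hF, Int.cast_neg, Int.cast_natCast, neg_mul, abs_neg, abs_of_nonneg hkh,
      ← sub_eq_add_neg]
    ring
  have hsplit := Finset.sum_filter_add_sum_filter_not s (fun k => |k| < (m : ℤ))
    (fun k => trapezoidWeight J j k * F k)
  have hfar : |∑ k ∈ s with ¬ |k| < (m : ℤ), trapezoidWeight J j k * F k| ≤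
      B * ∑ k ∈ s with ¬ |k| < (m : ℤ), (|(k : ℝ) * h| ^ (1 + α))⁻¹ := by
    rw [Finset.mul_sum]
    refine (Finset.abs_sum_le_sum_abs _ _).trans (Finset.sum_le_sum fun k hk => ?_)
    have hk' := Finset.mem_Icc.1 (Finset.mem_of_mem_erase (Finset.mem_of_mem_filter k hk))
    have hVk := hV (j + k) (abs_le.2 ⟨by omega, by omega⟩)
    have hd : 0 ≤ (|(k : ℝ) * h| ^ (1 + α))⁻¹ := by positivity
    rw [abs_mul, abs_of_nonneg (trapezoidWeight_nonneg J j k), hF]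
    simp only
    rw [div_eq_mul_inv, abs_mul, abs_of_nonneg hd]
    calc _ ≤ 1 * (B * (|(k : ℝ) * h| ^ (1 + α))⁻¹) := by
          gcongr; exact trapezoidWeight_le_one J j k
      _ = _ := one_mul _
  have hfar' := mul_sum_inv_abs_mul_rpow_le hα₀ hh hm ({k ∈ s | ¬ |k| < m} : Finset ℤ)
    (fun k hk => not_lt.1 (Finset.mem_filter.1 hk).2)
  rw [trapezoidSum_eq, ← hsplit, hnear, ← mul_sub, add_sub_cancel_left, abs_mul, abs_of_pos hh]
  calc _ ≤ h * (B * ∑ k ∈ s with ¬ |k| < (m : ℤ), (|(k : ℝ) * h| ^ (1 + α))⁻¹) := by gcongr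
    _ = B * (h * ∑ k ∈ s with ¬ |k| < (m : ℤ), (|(k : ℝ) * h| ^ (1 + α))⁻¹) := by ring
    _ ≤ _ := by gcongr

/-! ### The nonlocal operator in symmetric form -/

/-- `min(1, y²) y^(-1-α)`, which majorizes the integrands below up to constants; its
integrability on `(0, ∞)` is the Lévy condition. -/
noncomputable def truncatedLevyDensity (α y : ℝ) : ℝ := min 1 (y ^ 2) * y ^ (-(1 + α))

theorem integrableOn_truncatedLevyDensity {α : ℝ} (hα₀ : 0 < α) (hα₂ : α < 2) :
    IntegrableOn (truncatedLevyDensity α) (Ioi 0) := by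
  have hmeas : Measurable (truncatedLevyDensity α) := by
    unfold truncatedLevyDensity; fun_prop
  rw [← Ioc_union_Ioi_eq_Ioi zero_le_one]
  refine IntegrableOn.union ?_ ?_
  · have h1 : IntegrableOn (fun y : ℝ => y ^ (1 - α)) (Ioc 0 1) := by
      rw [integrableOn_Ioc_iff_integrableOn_Ioo, intervalIntegral.integrableOn_Ioo_rpow_iff one_pos]
      linarith
    refine h1.mono' hmeas.aestronglyMeasurable ?_
    filter_upwards [ae_restrict_mem measurableSet_Ioc] with y hy
    have hy0 := hy.1
    rw [truncatedLevyDensity, Real.norm_of_nonneg (by positivity)]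
    calc _ ≤ y ^ 2 * y ^ (-(1 + α)) := by gcongr; exact min_le_right _ _
      _ = y ^ (1 - α) := by
        rw [← Real.rpow_natCast, ← Real.rpow_add hy0]; congr 1; push_cast; ring
  · refine (integrableOn_Ioi_rpow_of_lt (a := -(1 + α)) (by linarith) one_pos).mono'
      hmeas.aestronglyMeasurable ?_
    filter_upwards [ae_restrict_mem measurableSet_Ioi] with y hy
    have hy0 : 0 < y := one_pos.trans hy
    rw [truncatedLevyDensity, Real.norm_of_nonneg (by positivity)]
    calc _ ≤ 1 * y ^ (-(1 + α)) := by gcongr; exact min_le_left _ _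
      _ = _ := one_mul _

theorem truncatedLevyDensity_nonneg {α y : ℝ} (hy : 0 ≤ y) : 0 ≤ truncatedLevyDensity α y := by
  unfold truncatedLevyDensity; positivity

/-- Mean value inequality based at `0`, for arguments of either sign. -/
theorem abs_le_mul_of_abs_deriv_le {f f' : ℝ → ℝ} {C y : ℝ} (h0 : f 0 = 0)
    (hf : ∀ z, HasDerivAt f (f' z) z) (hC : ∀ z, |z| ≤ |y| → |f' z| ≤ C) :
    |f y| ≤ C * |y| := by
  have := Convex.norm_image_sub_le_of_norm_hasDerivWithin_le (𝕜 := ℝ) (f := f) (f' := f')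
    (s := uIcc 0 y) (x := 0) (y := y) (C := C) (fun z _ => (hf z).hasDerivWithinAt)
    (fun z hz => hC z (by
      rcases le_total 0 y with h | h
      · rw [uIcc_of_le h] at hz; rw [abs_of_nonneg hz.1, abs_of_nonneg h]; exact hz.2
      · rw [uIcc_of_ge h] at hz; rw [abs_of_nonpos hz.2, abs_of_nonpos h]; linarith [hz.1]))
    (convex_uIcc 0 y) left_mem_uIcc right_mem_uIcc
  simpa [h0] using this

theorem abs_sub_sub_mul_le {v v₁ v₂ : ℝ → ℝ} {K : ℝ} (h₁ : ∀ x, HasDerivAt v (v₁ x) x)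
    (h₂ : ∀ x, HasDerivAt v₁ (v₂ x) x) (hK : ∀ x, |v₂ x| ≤ K) (x y : ℝ) :
    |v (x + y) - v x - y * v₁ x| ≤ K * y ^ 2 := by
  have hK0 : 0 ≤ K := (abs_nonneg _).trans (hK 0)
  have hd : ∀ z, |v₁ (x + z) - v₁ x| ≤ K * |z| := fun z =>
    abs_le_mul_of_abs_deriv_le (f := fun z => v₁ (x + z) - v₁ x) (by simp)
      (fun z => ((h₂ (x + z)).comp_const_add x z).sub_const _) (fun z _ => hK _)
  have := abs_le_mul_of_abs_deriv_le (f := fun z => v (x + z) - v x - z * v₁ x)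
    (f' := fun z => v₁ (x + z) - v₁ x) (y := y) (C := K * |y|) (by simp)
    (fun z => by
      have := (((h₁ (x + z)).comp_const_add x z).sub_const (v x)).fun_sub
        ((hasDerivAt_id' z).mul_const (v₁ x))
      rwa [one_mul] at this)
    (fun z hz => (hd z).trans (by gcongr))
  rwa [mul_assoc, ← sq, sq_abs] at this

theorem abs_secondDiff_le {v v₁ v₂ : ℝ → ℝ} {K : ℝ} (h₁ : ∀ x, HasDerivAt v (v₁ x) x)
    (h₂ : ∀ x, HasDerivAt v₁ (v₂ x) x) (hK₀ : ∀ x, |v x| ≤ K) (hK : ∀ x, |v₂ x| ≤ K) (x y : ℝ) :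
    |v (x + y) + v (x - y) - 2 * v x| ≤ 4 * K * min 1 (y ^ 2) := by
  have hK0 : 0 ≤ K := (abs_nonneg _).trans (hK 0)
  have e1 := abs_le.1 (abs_sub_sub_mul_le h₁ h₂ hK x y)
  have e2 := abs_le.1 (abs_sub_sub_mul_le h₁ h₂ hK x (-y))
  rw [← sub_eq_add_neg, neg_sq] at e2
  have b1 := abs_le.1 (hK₀ (x + y))
  have b2 := abs_le.1 (hK₀ (x - y))
  have b3 := abs_le.1 (hK₀ x)
  have hy : 0 ≤ K * y ^ 2 := by positivity
  rcases le_total 1 (y ^ 2) with h | h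
  · rw [min_eq_left h]
    exact abs_le.2 ⟨by linarith, by linarith⟩
  · rw [min_eq_right h]
    exact abs_le.2 ⟨by linarith, by linarith⟩

/-- `u` is `C⁴`, and its derivatives of order at most four are bounded by `K`. -/
structure HasBoundedDerivs (K : ℝ) (u : ℝ → ℝ) : Prop where
  contDiff : ContDiff ℝ 4 u
  bound : ∀ k : ℕ, k ≤ 4 → ∀ x, |iteratedDeriv k u x| ≤ K

namespace HasBoundedDerivs

variable {K : ℝ} {u : ℝ → ℝ}

theorem hasDerivAt (hu : HasBoundedDerivs K u) {k : ℕ} (hk : k < 4) (x : ℝ) :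
    HasDerivAt (iteratedDeriv k u) (iteratedDeriv (k + 1) u x) x := by
  rw [iteratedDeriv_succ]
  exact (hu.contDiff.differentiable_iteratedDeriv k (by exact_mod_cast hk) x).hasDerivAt

theorem hasDerivAt_zero (hu : HasBoundedDerivs K u) (x : ℝ) :
    HasDerivAt u (iteratedDeriv 1 u x) x := by
  simpa using hu.hasDerivAt (k := 0) (by norm_num) x

theorem abs_apply_le (hu : HasBoundedDerivs K u) (x : ℝ) : |u x| ≤ K := by
  simpa using hu.bound 0 (by norm_num) x

theorem nonneg (hu : HasBoundedDerivs K u) : 0 ≤ K := (abs_nonneg _).trans (hu.abs_apply_le 0)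

end HasBoundedDerivs

/-- The symmetric second difference `u(x+y) + u(x-y) - 2 u(x)`. -/
noncomputable def secondDiff (u : ℝ → ℝ) (x y : ℝ) : ℝ := u (x + y) + u (x - y) - 2 * u x

theorem HasBoundedDerivs.abs_secondDiff_le {K : ℝ} {u : ℝ → ℝ} (hu : HasBoundedDerivs K u)
    (x y : ℝ) : |secondDiff u x y| ≤ 4 * K * min 1 (y ^ 2) :=
  NonlocalFP.abs_secondDiff_le hu.hasDerivAt_zero (hu.hasDerivAt (k := 1) (by norm_num))
    hu.abs_apply_le (hu.bound 2 (by norm_num)) x y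

theorem HasBoundedDerivs.continuous_secondDiff {K : ℝ} {u : ℝ → ℝ} (hu : HasBoundedDerivs K u)
    (x : ℝ) : Continuous (secondDiff u x) := by
  have := hu.contDiff.continuous
  unfold secondDiff
  fun_prop

theorem HasBoundedDerivs.integrableOn_secondDiff {K α : ℝ} {u : ℝ → ℝ} (hu : HasBoundedDerivs K u)
    (hα₀ : 0 < α) (hα₂ : α < 2) (x : ℝ) :
    IntegrableOn (fun y => secondDiff u x y * y ^ (-(1 + α))) (Ioi 0) := by
  refine ((integrableOn_truncatedLevyDensity hα₀ hα₂).const_mul (4 * K)).mono' ?_ ?_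
  · have := (hu.continuous_secondDiff x).measurable
    exact (this.mul (by fun_prop)).aestronglyMeasurable
  · filter_upwards [ae_restrict_mem measurableSet_Ioi] with y hy
    have hy0 : (0 : ℝ) < y := hy
    rw [norm_mul, Real.norm_of_nonneg (Real.rpow_nonneg hy0.le _), truncatedLevyDensity,
      ← mul_assoc]
    gcongr
    exact hu.abs_secondDiff_le x y

/-- Pairing `y` with `-y` removes the compensator `1_{|y|<1} y u'(x)` from the nonlocal operator. -/
theorem HasBoundedDerivs.fokkerPlanckRHS_eq {K α ε : ℝ} {u : ℝ → ℝ} (hu : HasBoundedDerivs K u)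
    (hα₀ : 0 < α) (hα₂ : α < 2) (x : ℝ) :
    fokkerPlanckRHS (fun _ => 0) 0 α ε u x =
      ε * levyConst α * ∫ y in Ioi 0, secondDiff u x y * y ^ (-(1 + α)) := by
  have hK := hu.nonneg
  set F : ℝ → ℝ := fun y => (u (x + y) - u x - (if |y| < 1 then y * deriv u x else 0)) *
        (ε * (levyConst α * |y| ^ (-(1 + α)))) with hF
  have hd : deriv u x = iteratedDeriv 1 u x := (hu.hasDerivAt_zero x).deriv
  have hmeas : Measurable F := by
    have := hu.contDiff.continuous.measurable
    refine Measurable.mul (Measurable.sub (by fun_prop) ?_) (by fun_prop)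
    exact Measurable.ite (measurableSet_lt (by fun_prop) (by fun_prop)) (by fun_prop) (by fun_prop)
  have hbound : ∀ y, |u (x + y) - u x - (if |y| < 1 then y * deriv u x else 0)| ≤
      2 * K * min 1 (y ^ 2) := by
    intro y
    split_ifs with hy
    · have h1 : y ^ 2 ≤ 1 := (sq_le_one_iff_abs_le_one y).2 hy.le
      rw [min_eq_right h1, hd]
      refine (abs_sub_sub_mul_le hu.hasDerivAt_zero (hu.hasDerivAt (k := 1) (by norm_num))
        (hu.bound 2 (by norm_num)) x y).trans ?_
      have : 0 ≤ K * y ^ 2 := by positivity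
      linarith
    · have h1 : 1 ≤ y ^ 2 := (one_le_sq_iff_one_le_abs y).2 (not_lt.1 hy)
      rw [min_eq_left h1, sub_zero]
      have := abs_sub (u (x + y)) (u x)
      linarith [hu.abs_apply_le (x + y), hu.abs_apply_le x]
  have hFb : ∀ y, 0 < |y| → ‖F y‖ ≤ 2 * K * |ε * levyConst α| * truncatedLevyDensity α |y| := by
    intro y hy
    have : 0 ≤ |y| ^ (-(1 + α)) := by positivity
    rw [hF, Real.norm_eq_abs, abs_mul, ← mul_assoc ε, abs_mul (ε * _), abs_of_nonneg this,
      truncatedLevyDensity, sq_abs]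
    calc _ ≤ 2 * K * min 1 (y ^ 2) * (|ε * levyConst α| * |y| ^ (-(1 + α))) := by
          gcongr; exact hbound y
      _ = _ := by ring
  have hint := (integrableOn_truncatedLevyDensity hα₀ hα₂).const_mul (2 * K * |ε * levyConst α|)
  have hpos : IntegrableOn F (Ioi 0) := by
    refine hint.mono' hmeas.aestronglyMeasurable ?_
    filter_upwards [ae_restrict_mem measurableSet_Ioi] with y hy
    have := hFb y (abs_pos.2 (ne_of_gt hy))
    rwa [abs_of_pos (show (0 : ℝ) < y from hy)] at this
  have hneg' : IntegrableOn (fun y => F (-y)) (Ioi 0) := by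
    refine hint.mono' (hmeas.comp measurable_neg).aestronglyMeasurable ?_
    filter_upwards [ae_restrict_mem measurableSet_Ioi] with y hy
    have := hFb (-y) (abs_pos.2 (neg_ne_zero.2 (ne_of_gt hy)))
    rwa [abs_neg, abs_of_pos (show (0 : ℝ) < y from hy)] at this
  have hneg : IntegrableOn F (Iic 0) := by
    have h := IntegrableOn.comp_neg_Iio (c := (0 : ℝ)) (f := fun y => F (-y)) (by rwa [neg_zero])
    simp only [neg_neg] at h
    rwa [integrableOn_Iic_iff_integrableOn_Iio]
  have hae : ∫ y in ({0}ᶜ : Set ℝ), F y = ∫ y, F y := by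
    rw [restrict_compl_singleton]
  have hsplit := intervalIntegral.integral_Iic_add_Ioi hneg hpos
  have hcn := integral_comp_neg_Ioi 0 F
  rw [neg_zero] at hcn
  have hz : deriv (fun y => (fun _ : ℝ => (0 : ℝ)) y * u y) x = 0 := by simp
  rw [fokkerPlanckRHS, hz, hae, ← hsplit, ← hcn, ← integral_add hneg' hpos,
    ← integral_const_mul, zero_div, zero_mul, neg_zero, zero_add, zero_add]
  refine setIntegral_congr_fun measurableSet_Ioi fun y hy => ?_
  have hy0 : (0 : ℝ) < y := hy
  simp only [hF, secondDiff, abs_neg, abs_of_pos hy0, ← sub_eq_add_neg]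
  split_ifs <;> ring

/-! ### Quadrature of the symmetric integral -/

/-- Mean value inequality on `[0, y]` for a derivative with a monotone majorant. -/
theorem abs_le_mul_self_of_abs_deriv_le {f f' b : ℝ → ℝ} (h0 : f 0 = 0)
    (hf : ∀ z, HasDerivAt f (f' z) z) (hb : MonotoneOn b (Ici 0)) (hb' : ∀ z, 0 ≤ z → |f' z| ≤ b z)
    {y : ℝ} (hy : 0 ≤ y) : |f y| ≤ b y * y := by
  have := Convex.norm_image_sub_le_of_norm_hasDerivWithin_le (𝕜 := ℝ) (f := f) (f' := f')
    (s := Icc 0 y) (x := 0) (y := y) (C := b y) (fun z _ => (hf z).hasDerivWithinAt)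
    (fun z hz => (hb' z hz.1).trans (hb hz.1 hy hz.2))
    (convex_Icc 0 y) (left_mem_Icc.2 hy) (right_mem_Icc.2 hy)
  simpa [h0, abs_of_nonneg hy] using this

theorem monotoneOn_min_one_sq {C : ℝ} (hC : 0 ≤ C) (n : ℕ) :
    MonotoneOn (fun y : ℝ => C * min 1 (y ^ 2) * y ^ n) (Ici 0) := by
  intro a ha b hb hab
  have ha' : (0 : ℝ) ≤ a := ha
  have hb' : (0 : ℝ) ≤ b := hb
  simp only
  gcongr

/-- The second difference minus its leading part `u''(x) y²`; it is `O(y⁴)` at `0`. -/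
noncomputable def diffRemainder (u : ℝ → ℝ) (x y : ℝ) : ℝ :=
  secondDiff u x y - iteratedDeriv 2 u x * y ^ 2

/-- The derivative of `diffRemainder u x`. -/
noncomputable def diffRemainder₁ (u : ℝ → ℝ) (x y : ℝ) : ℝ :=
  iteratedDeriv 1 u (x + y) - iteratedDeriv 1 u (x - y) - 2 * iteratedDeriv 2 u x * y

namespace HasBoundedDerivs

variable {K : ℝ} {u : ℝ → ℝ}

theorem hasDerivAt_diffRemainder (hu : HasBoundedDerivs K u) (x y : ℝ) :
    HasDerivAt (diffRemainder u x) (diffRemainder₁ u x y) y := by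
  have h1 := (hu.hasDerivAt_zero (x + y)).comp_const_add x y
  have h2 := (hu.hasDerivAt_zero (x - y)).comp_const_sub x y
  have h3 := ((hasDerivAt_id y).pow 2).const_mul (iteratedDeriv 2 u x)
  have := (((h1.add h2).sub_const (2 * u x)).sub h3)
  refine this.congr_deriv ?_
  simp [diffRemainder₁]
  ring

theorem hasDerivAt_diffRemainder₁ (hu : HasBoundedDerivs K u) (x y : ℝ) :
    HasDerivAt (diffRemainder₁ u x) (secondDiff (iteratedDeriv 2 u) x y) y := by
  have h1 := (hu.hasDerivAt (k := 1) (by norm_num) (x + y)).comp_const_add x y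
  have h2 := (hu.hasDerivAt (k := 1) (by norm_num) (x - y)).comp_const_sub x y
  have h3 := (hasDerivAt_id y).const_mul (2 * iteratedDeriv 2 u x)
  refine ((h1.sub h2).sub h3).congr_deriv ?_
  simp [secondDiff]

theorem abs_secondDiff_iteratedDeriv_le (hu : HasBoundedDerivs K u) (x y : ℝ) :
    |secondDiff (iteratedDeriv 2 u) x y| ≤ 4 * K * min 1 (y ^ 2) :=
  NonlocalFP.abs_secondDiff_le (hu.hasDerivAt (k := 2) (by norm_num))
    (hu.hasDerivAt (k := 3) (by norm_num)) (hu.bound 2 (by norm_num)) (hu.bound 4 le_rfl) x y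

theorem abs_diffRemainder₁_le (hu : HasBoundedDerivs K u) (x : ℝ) {y : ℝ} (hy : 0 ≤ y) :
    |diffRemainder₁ u x y| ≤ 4 * K * min 1 (y ^ 2) * y := by
  have hK := hu.nonneg
  simpa using abs_le_mul_self_of_abs_deriv_le (by simp [diffRemainder₁])
    (hu.hasDerivAt_diffRemainder₁ x) (monotoneOn_min_one_sq (C := 4 * K) (by positivity) 0)
    (fun z _ => by simpa using hu.abs_secondDiff_iteratedDeriv_le x z) hy

theorem abs_diffRemainder_le (hu : HasBoundedDerivs K u) (x : ℝ) {y : ℝ} (hy : 0 ≤ y) :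
    |diffRemainder u x y| ≤ 4 * K * min 1 (y ^ 2) * y ^ 2 := by
  have hK := hu.nonneg
  have := abs_le_mul_self_of_abs_deriv_le (by simp [diffRemainder, secondDiff]; ring)
    (hu.hasDerivAt_diffRemainder x) (monotoneOn_min_one_sq (C := 4 * K) (by positivity) 1)
    (fun z hz => by simpa using hu.abs_diffRemainder₁_le x hz) hy
  simpa [mul_assoc, sq] using this

theorem abs_diffRemainder_le_pow (hu : HasBoundedDerivs K u) (x : ℝ) {y : ℝ} (hy : 0 ≤ y) :
    |diffRemainder u x y| ≤ 4 * K * y ^ 4 := by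
  have hK := hu.nonneg
  refine (hu.abs_diffRemainder_le x hy).trans ?_
  calc _ ≤ 4 * K * y ^ 2 * y ^ 2 := by gcongr; exact min_le_right _ _
    _ = _ := by ring

/-- Once the leading part `u''(x) y^(1-α)` of the integrand is subtracted, the trapezoidal rule on
`[h, m h]` is of second order, uniformly in `m`: the second derivative of the remaining integrand
is dominated by the integrable function `truncatedLevyDensity α`. -/
theorem abs_sum_trapezoid_diffRemainder_sub_le (hu : HasBoundedDerivs K u) {α h : ℝ}
    (hα₀ : 0 < α) (hα₂ : α < 2) (hh : 0 < h) {m : ℕ} (hm : 1 ≤ m) (x : ℝ) :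
    |∑ k ∈ Finset.Ico 1 m, h / 2 * (diffRemainder u x (k * h) * (k * h) ^ (-(1 + α)) +
        diffRemainder u x ((k + 1 : ℕ) * h) * ((k + 1 : ℕ) * h) ^ (-(1 + α))) -
      ∫ y in h..(m * h), diffRemainder u x y * y ^ (-(1 + α))| ≤
      10 * K * (∫ y in Ioi 0, truncatedLevyDensity α y) * h ^ 2 := by
  have hK := hu.nonneg
  have hm1 : (1 : ℝ) ≤ m := by exact_mod_cast hm
  have hle : h ≤ m * h := by nlinarith
  have hpos : ∀ y ∈ Icc h (m * h), 0 < y := fun y hy => hh.trans_le hy.1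
  set a := -(1 + α) with ha
  have hint := integrableOn_truncatedLevyDensity hα₀ hα₂
  have hg : IntervalIntegrable (fun y => 76 * K * truncatedLevyDensity α y) volume h (m * h) := by
    rw [intervalIntegrable_iff_integrableOn_Ioc_of_le hle]
    exact (hint.mono_set fun y hy => hh.trans hy.1).const_mul _
  have hd : ∀ (b : ℝ) {y : ℝ}, 0 < y → HasDerivAt (fun y : ℝ => y ^ b) (b * y ^ (b - 1)) y :=
    fun b y hy => Real.hasDerivAt_rpow_const (Or.inl hy.ne')
  have key := norm_sum_trapezoid_sub_integral_le (E := ℝ) (m := 1) (n := m) (h := h)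
    (f := fun y => diffRemainder u x y * y ^ a)
    (f' := fun y => diffRemainder₁ u x y * y ^ a + diffRemainder u x y * (a * y ^ (a - 1)))
    (f'' := fun y => (secondDiff (iteratedDeriv 2 u) x y * y ^ a +
        diffRemainder₁ u x y * (a * y ^ (a - 1))) +
      (diffRemainder₁ u x y * (a * y ^ (a - 1)) +
        diffRemainder u x y * (a * ((a - 1) * y ^ (a - 1 - 1)))))
    (g := fun y => 76 * K * truncatedLevyDensity α y) hh.le hm
    (by
      rw [Nat.cast_one, one_mul]
      exact fun y hy => (hu.hasDerivAt_diffRemainder x y).fun_mul (hd a (hpos y hy)))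
    (by
      rw [Nat.cast_one, one_mul]
      exact fun y hy => ((hu.hasDerivAt_diffRemainder₁ x y).fun_mul (hd a (hpos y hy))).fun_add
        ((hu.hasDerivAt_diffRemainder x y).fun_mul ((hd (a - 1) (hpos y hy)).const_mul a)))
    (by
      rw [Nat.cast_one, one_mul]
      have c0 : Continuous (diffRemainder u x) :=
        continuous_iff_continuousAt.2 fun y => (hu.hasDerivAt_diffRemainder x y).continuousAt
      have c1 : Continuous (diffRemainder₁ u x) :=
        continuous_iff_continuousAt.2 fun y => (hu.hasDerivAt_diffRemainder₁ x y).continuousAt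
      have c2 : Continuous (secondDiff (iteratedDeriv 2 u) x) := by
        have : Continuous (iteratedDeriv 2 u) :=
          continuous_iff_continuousAt.2 fun y =>
            (hu.hasDerivAt (k := 2) (by norm_num) y).continuousAt
        unfold secondDiff; fun_prop
      have cr : ∀ b : ℝ, ContinuousOn (fun y : ℝ => y ^ b) (Icc h (m * h)) := fun b y hy =>
        (hd b (hpos y hy)).continuousAt.continuousWithinAt
      exact ((c2.continuousOn.mul (cr _)).add (c1.continuousOn.mul ((cr _).const_mul _))).add
        ((c1.continuousOn.mul ((cr _).const_mul _)).add
          (c0.continuousOn.mul (((cr _).const_mul _).const_mul _))))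
    (by rwa [Nat.cast_one, one_mul])
    (by
      rw [Nat.cast_one, one_mul]
      intro y hy
      have hy0 := hpos y hy
      have e1 : y ^ (a - 1) = y ^ a / y := Real.rpow_sub_one hy0.ne' a
      have e2 : y ^ (a - 1 - 1) = y ^ a / y ^ 2 := by
        rw [Real.rpow_sub_one hy0.ne', e1]; field_simp
      have b0 := hu.abs_diffRemainder_le x hy0.le
      have b1 := hu.abs_diffRemainder₁_le x hy0.le
      have b2 := hu.abs_secondDiff_iteratedDeriv_le x y
      set ρ := 4 * K * min 1 (y ^ 2) with hρ
      have hρ0 : 0 ≤ ρ := by positivity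
      have hya : 0 < y ^ a := Real.rpow_pos_of_pos hy0 a
      have b1' : |diffRemainder₁ u x y / y| ≤ ρ := by
        rw [abs_div, abs_of_pos hy0]; exact (div_le_iff₀ hy0).2 b1
      have b0' : |diffRemainder u x y / y ^ 2| ≤ ρ := by
        rw [abs_div, abs_of_pos (pow_pos hy0 2)]; exact (div_le_iff₀ (pow_pos hy0 2)).2 b0
      have ha3 : |a| ≤ 3 := abs_le.2 ⟨by linarith, by linarith⟩
      have ha4 : |a - 1| ≤ 4 := abs_le.2 ⟨by linarith, by linarith⟩
      have hval : (secondDiff (iteratedDeriv 2 u) x y * y ^ a +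
            diffRemainder₁ u x y * (a * y ^ (a - 1))) +
          (diffRemainder₁ u x y * (a * y ^ (a - 1)) +
            diffRemainder u x y * (a * ((a - 1) * y ^ (a - 1 - 1)))) =
          (secondDiff (iteratedDeriv 2 u) x y + 2 * a * (diffRemainder₁ u x y / y) +
            a * (a - 1) * (diffRemainder u x y / y ^ 2)) * y ^ a := by
        rw [e1, e2]; ring
      rw [hval, norm_mul, Real.norm_of_nonneg hya.le, truncatedLevyDensity, ← mul_assoc]
      refine mul_le_mul_of_nonneg_right ?_ hya.le
      have t1 : |2 * a * (diffRemainder₁ u x y / y)| ≤ 6 * ρ := by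
        rw [abs_mul, abs_mul, abs_two]
        calc _ ≤ 2 * 3 * ρ := by gcongr
          _ = _ := by ring
      have t2 : |a * (a - 1) * (diffRemainder u x y / y ^ 2)| ≤ 12 * ρ := by
        rw [abs_mul, abs_mul]
        calc _ ≤ 3 * 4 * ρ := by gcongr
          _ = _ := by ring
      calc _ ≤ _ := norm_add₃_le
        _ ≤ ρ + 6 * ρ + 12 * ρ := add_le_add (add_le_add b2 t1) t2
        _ = _ := by rw [hρ]; ring)
  rw [Nat.cast_one, one_mul] at key
  refine key.trans ?_
  have hI : ∫ y in h..(m * h), 76 * K * truncatedLevyDensity α y ≤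
      76 * K * ∫ y in Ioi 0, truncatedLevyDensity α y := by
    rw [intervalIntegral.integral_const_mul, intervalIntegral.integral_of_le hle]
    refine mul_le_mul_of_nonneg_left (setIntegral_mono_set hint ?_ ?_) (by positivity)
    · filter_upwards [ae_restrict_mem measurableSet_Ioi] with y hy
      exact truncatedLevyDensity_nonneg (le_of_lt hy)
    · exact (Ioc_subset_Ioi_self.trans (Ioi_subset_Ioi hh.le)).eventuallyLE
  have hI0 : 0 ≤ ∫ y in Ioi 0, truncatedLevyDensity α y :=
    setIntegral_nonneg measurableSet_Ioi fun y hy => truncatedLevyDensity_nonneg (le_of_lt hy)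
  calc _ ≤ h ^ 2 / 8 * (76 * K * ∫ y in Ioi 0, truncatedLevyDensity α y) := by gcongr
    _ ≤ _ := by
      have : 0 ≤ K * (∫ y in Ioi 0, truncatedLevyDensity α y) * h ^ 2 := by positivity
      linarith

end HasBoundedDerivs

theorem sum_trapezoid_eq (R : ℕ → ℝ) (h : ℝ) {m : ℕ} (hm : 1 ≤ m) :
    ∑ k ∈ Finset.Ico 1 m, h / 2 * (R k + R (k + 1)) =
      h * ∑ k ∈ Finset.Ico 1 m, R k - h / 2 * R 1 + h / 2 * R m := by
  induction m, hm using Nat.le_induction with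
  | base => simp
  | succ n hn ih =>
    rw [Finset.sum_Ico_succ_top hn, ih, Finset.sum_Ico_succ_top hn]
    ring

namespace HasBoundedDerivs

variable {K : ℝ} {u : ℝ → ℝ}

theorem abs_integral_diffRemainder_le (hu : HasBoundedDerivs K u) {α h : ℝ}
    (hα₂ : α < 2) (hh : 0 < h) (x : ℝ) :
    |∫ y in (0 : ℝ)..h, diffRemainder u x y * y ^ (-(1 + α))| ≤ 4 * K * h ^ (4 - α) := by
  have hK := hu.nonneg
  have h1 : ∀ y ∈ uIoc 0 h, ‖diffRemainder u x y * y ^ (-(1 + α))‖ ≤ 4 * K * h ^ (3 - α) := by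
    intro y hy
    rw [uIoc_of_le hh.le] at hy
    have hy0 := hy.1
    rw [norm_mul, Real.norm_of_nonneg (Real.rpow_nonneg hy0.le _)]
    calc _ ≤ 4 * K * y ^ 4 * y ^ (-(1 + α)) := by
          gcongr; exact hu.abs_diffRemainder_le_pow x hy0.le
      _ = 4 * K * y ^ (3 - α) := by
          rw [mul_assoc, ← Real.rpow_natCast, ← Real.rpow_add hy0]; congr 2; push_cast; ring
      _ ≤ _ := by
          gcongr
          · linarith
          · exact hy.2
  have := intervalIntegral.norm_integral_le_of_norm_le_const h1
  rw [sub_zero, abs_of_pos hh, Real.norm_eq_abs] at this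
  refine this.trans (le_of_eq ?_)
  rw [mul_assoc, ← Real.rpow_add_one hh.ne']
  congr 2; ring

/-- The corrected symmetric quadrature approximates the nonlocal operator with an error
`O(h² + (m h)^(-α))`. The leading part `u''(x) y²` of the second difference produces the quadrature
error `ζ(α-1) u''(x) h^(2-α)`, which the correction term cancels up to `O(h^(4-α))`. -/
theorem abs_quadrature_sub_le (hu : HasBoundedDerivs K u) {α h : ℝ}
    (hα₀ : 0 < α) (hα₂ : α < 2) (hh : 0 < h) (hh1 : h ≤ 1) {m : ℕ} (hm : 1 ≤ m) (x : ℝ) :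
    |-zetaConst α * h ^ (-α) * secondDiff u x h +
        h * ∑ k ∈ Finset.Ico 1 m, secondDiff u x (k * h) / (k * h) ^ (1 + α) -
        ∫ y in Ioi 0, secondDiff u x y * y ^ (-(1 + α))| ≤
      K * ((10 * (∫ y in Ioi 0, truncatedLevyDensity α y) + 6 - 4 * zetaConst α) * h ^ 2 +
        (3 + 4 / α) * (m * h) ^ (-α)) := by
  have hK := hu.nonneg
  have hζ := zetaConst_nonpos hα₀ hα₂
  have hm1 : (1 : ℝ) ≤ m := by exact_mod_cast hm
  have hm0 : (0 : ℝ) < m := by linarith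
  have hmh : 0 < m * h := by positivity
  have hle : h ≤ m * h := by nlinarith
  set a := -(1 + α) with ha
  set d := iteratedDeriv 2 u x with hd
  set I := ∫ y in Ioi 0, truncatedLevyDensity α y with hI
  have hda : |d| ≤ K := hu.bound 2 (by norm_num) x
  set R : ℕ → ℝ := fun k => diffRemainder u x (k * h) * (k * h) ^ a with hR
  have hint := hu.integrableOn_secondDiff hα₀ hα₂ x
  have hpow : ∀ {y : ℝ}, 0 < y → y ^ 2 * y ^ a = y ^ (1 - α) := fun {y} hy => by
    rw [← Real.rpow_natCast, ← Real.rpow_add hy]; congr 1; push_cast; ring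
  have hg : ∀ {y : ℝ}, 0 < y →
      secondDiff u x y * y ^ a = diffRemainder u x y * y ^ a + d * y ^ (1 - α) := fun {y} hy => by
    rw [← hpow hy, diffRemainder]; ring
  have hsum : h * ∑ k ∈ Finset.Ico 1 m, secondDiff u x (k * h) / (k * h) ^ (1 + α) =
      h * ∑ k ∈ Finset.Ico 1 m, R k +
        d * h ^ (2 - α) * ∑ k ∈ Finset.Ico 1 m, (k : ℝ) ^ (1 - α) := by
    have e : h ^ (2 - α) = h * h ^ (1 - α) := by
      rw [← Real.rpow_one_add' hh.le (by linarith)]; congr 1; ring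
    rw [e, show d * (h * h ^ (1 - α)) = h * (d * h ^ (1 - α)) by ring, mul_assoc h, ← mul_add,
      Finset.mul_sum _ _ (d * _), ← Finset.sum_add_distrib]
    congr 1
    refine Finset.sum_congr rfl fun k hk => ?_
    have hk0 : (0 : ℝ) < k := by exact_mod_cast (Finset.mem_Ico.1 hk).1
    rw [div_eq_mul_inv, ← Real.rpow_neg (by positivity), hg (by positivity), hR,
      Real.mul_rpow hk0.le hh.le (z := 1 - α)]
    ring
  have hi1 : IntervalIntegrable (fun y => secondDiff u x y * y ^ a) volume 0 (m * h) := by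
    rw [intervalIntegrable_iff_integrableOn_Ioc_of_le hmh.le]
    exact hint.mono_set Ioc_subset_Ioi_self
  have hi2 : IntervalIntegrable (fun y : ℝ => d * y ^ (1 - α)) volume 0 (m * h) :=
    (intervalIntegral.intervalIntegrable_rpow' (by linarith)).const_mul _
  have hcongr : EqOn (fun y => secondDiff u x y * y ^ a - d * y ^ (1 - α))
      (fun y => diffRemainder u x y * y ^ a) (uIoc 0 (m * h)) := by
    intro y hy
    rw [uIoc_of_le hmh.le] at hy
    simp only [hg hy.1, add_sub_cancel_right]
  have hi3 : IntervalIntegrable (fun y => diffRemainder u x y * y ^ a) volume 0 (m * h) :=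
    (hi1.sub hi2).congr hcongr
  have hsub1 : uIcc 0 h ⊆ uIcc 0 (m * h) := by
    rw [uIcc_of_le hh.le, uIcc_of_le hmh.le]; exact Icc_subset_Icc_right hle
  have hsub2 : uIcc h (m * h) ⊆ uIcc 0 (m * h) := by
    rw [uIcc_of_le hle, uIcc_of_le hmh.le]; exact Icc_subset_Icc_left hh.le
  have hrem : ∫ y in (0 : ℝ)..(m * h), diffRemainder u x y * y ^ a =
      (∫ y in (0 : ℝ)..(m * h), secondDiff u x y * y ^ a) -
        d * ((m * h) ^ (2 - α) / (2 - α)) := by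
    rw [← intervalIntegral.integral_congr_ae (ae_of_all _ fun y hy => hcongr hy),
      intervalIntegral.integral_sub hi1 hi2,
      intervalIntegral.integral_const_mul, integral_rpow (Or.inl (by linarith)),
      show 1 - α + 1 = 2 - α by ring, Real.zero_rpow (by linarith), sub_zero]
  have hadj := intervalIntegral.integral_add_adjacent_intervals (hi3.mono_set hsub1)
    (hi3.mono_set hsub2)
  have htail : (∫ y in (0 : ℝ)..(m * h), secondDiff u x y * y ^ a) +
      ∫ y in Ioi (m * h), secondDiff u x y * y ^ a = ∫ y in Ioi 0, secondDiff u x y * y ^ a := by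
    rw [intervalIntegral.integral_of_le hmh.le, ← setIntegral_union Ioc_disjoint_Ioi_same
      measurableSet_Ioi (hint.mono_set Ioc_subset_Ioi_self)
      (hint.mono_set (Ioi_subset_Ioi hmh.le)), Ioc_union_Ioi_eq_Ioi hmh.le]
  have hbd : ∀ y, |secondDiff u x y| ≤ 4 * K := fun y =>
    (hu.abs_secondDiff_le x y).trans (mul_le_of_le_one_right (by positivity) (min_le_left _ _))
  have htail_le : |∫ y in Ioi (m * h), secondDiff u x y * y ^ a| ≤ 4 / α * K * (m * h) ^ (-α) := by
    have hib := (integrableOn_Ioi_rpow_of_lt (a := a) (by linarith) hmh).const_mul (4 * K)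
    have := norm_integral_le_of_norm_le (f := fun y => secondDiff u x y * y ^ a) hib ?_
    · rw [integral_const_mul, integral_Ioi_rpow_of_lt (by linarith) hmh, Real.norm_eq_abs,
        show a + 1 = -α by rw [ha]; ring] at this
      refine this.trans (le_of_eq ?_)
      field_simp
    · filter_upwards [ae_restrict_mem measurableSet_Ioi] with y hy
      have hy0 : 0 < y := hmh.trans hy
      rw [norm_mul, Real.norm_of_nonneg (Real.rpow_nonneg hy0.le _)]
      gcongr
      exact hbd y
  have htrap : |∑ k ∈ Finset.Ico 1 m, h / 2 * (R k + R (k + 1)) -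
      ∫ y in h..(m * h), diffRemainder u x y * y ^ a| ≤ 10 * K * I * h ^ 2 :=
    hu.abs_sum_trapezoid_diffRemainder_sub_le hα₀ hα₂ hh hm x
  have hfirst : |∫ y in (0 : ℝ)..h, diffRemainder u x y * y ^ a| ≤ 4 * K * h ^ (4 - α) :=
    hu.abs_integral_diffRemainder_le hα₂ hh x
  have hsumR := sum_trapezoid_eq R h hm
  have hpT := abs_powerTrapezoid_sub_le hα₀ hα₂ hm
  have h4 : h ^ (4 - α) ≤ h ^ 2 := by
    rw [← Real.rpow_natCast]
    exact Real.rpow_le_rpow_of_exponent_ge hh hh1 (by push_cast; linarith)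
  have hr4 : h ^ 4 * h ^ (-α) = h ^ (4 - α) := by
    rw [← Real.rpow_natCast, ← Real.rpow_add hh]; congr 1
  have hr := hu.abs_diffRemainder_le_pow x hh.le
  have hR1 : |h / 2 * R 1| ≤ 2 * K * h ^ (4 - α) := by
    have : h * h ^ a = h ^ (-α) := by
      rw [← Real.rpow_one_add' hh.le (by linarith)]; congr 1; rw [ha]; ring
    have e : h / 2 * R 1 = diffRemainder u x h / 2 * h ^ (-α) := by
      rw [hR, ← this]; simp only [Nat.cast_one, one_mul]; ring
    rw [e, abs_mul, abs_div, abs_two, abs_of_pos (Real.rpow_pos_of_pos hh _), ← hr4]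
    calc _ ≤ 4 * K * h ^ 4 / 2 * h ^ (-α) := by gcongr
      _ = _ := by ring
  have hmhα : (m * h) * (m * h) ^ a = (m * h) ^ (-α) := by
    rw [← Real.rpow_one_add' hmh.le (by linarith)]; congr 1; rw [ha]; ring
  have hend : |h / 2 * (secondDiff u x (m * h) * (m * h) ^ a)| ≤ 2 * K * (m * h) ^ (-α) := by
    rw [abs_mul, abs_mul, abs_of_pos (Real.rpow_pos_of_pos hmh _), abs_of_pos (by positivity),
      ← hmhα]
    calc _ ≤ (m * h) / 2 * (4 * K * (m * h) ^ a) := by gcongr; exact hbd _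
      _ = _ := by ring
  have hcorr : |-zetaConst α * h ^ (-α) * diffRemainder u x h| ≤
      -zetaConst α * (4 * K * h ^ (4 - α)) := by
    rw [abs_mul, abs_mul, abs_of_nonneg (neg_nonneg.2 hζ),
      abs_of_pos (Real.rpow_pos_of_pos hh _), ← hr4, mul_assoc]
    refine mul_le_mul_of_nonneg_left ?_ (by linarith)
    calc _ ≤ h ^ (-α) * (4 * K * h ^ 4) := by gcongr
      _ = _ := by ring
  -- `h ≤ 1` absorbs the factor `h²` in `h^(2-α) m^(-α) = h² (m h)^(-α)`
  have hh2α : h ^ (2 - α) * (m : ℝ) ^ (-α) ≤ (m * h) ^ (-α) := by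
    rw [Real.mul_rpow hm0.le hh.le, mul_comm]
    gcongr 1
    exact Real.rpow_le_rpow_of_exponent_ge hh hh1 (by linarith)
  have hpow' : |d * h ^ (2 - α) * (powerTrapezoid α m - zetaConst α)| ≤ K * (m * h) ^ (-α) := by
    rw [abs_mul, abs_mul, abs_of_pos (Real.rpow_pos_of_pos hh _), mul_assoc]
    calc _ ≤ K * (h ^ (2 - α) * (m : ℝ) ^ (-α)) := by gcongr
      _ ≤ _ := by gcongr
  have hδ : -zetaConst α * h ^ (-α) * secondDiff u x h =
      -zetaConst α * h ^ (-α) * diffRemainder u x h - zetaConst α * (d * h ^ (2 - α)) := by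
    have : h ^ 2 * h ^ (-α) = h ^ (2 - α) := by
      rw [← Real.rpow_natCast, ← Real.rpow_add hh]; congr 1
    rw [← this, diffRemainder]; ring
  have hRm : h / 2 * R m = h / 2 * (secondDiff u x (m * h) * (m * h) ^ a) -
      d * h ^ (2 - α) * ((m : ℝ) ^ (1 - α) / 2) := by
    have : h * h ^ (1 - α) = h ^ (2 - α) := by
      rw [← Real.rpow_one_add' hh.le (by linarith)]; congr 1; ring
    rw [hg hmh, Real.mul_rpow hm0.le hh.le (z := 1 - α), ← this]; ring
  have hmpow : (m * h) ^ (2 - α) / (2 - α) = h ^ (2 - α) * ((m : ℝ) ^ (2 - α) / (2 - α)) := by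
    rw [Real.mul_rpow hm0.le hh.le]; ring
  have hfinal : -zetaConst α * h ^ (-α) * secondDiff u x h +
        h * ∑ k ∈ Finset.Ico 1 m, secondDiff u x (k * h) / (k * h) ^ (1 + α) -
        ∫ y in Ioi 0, secondDiff u x y * y ^ a =
      -zetaConst α * h ^ (-α) * diffRemainder u x h +
      (∑ k ∈ Finset.Ico 1 m, h / 2 * (R k + R (k + 1)) -
        ∫ y in h..(m * h), diffRemainder u x y * y ^ a) + h / 2 * R 1 -
      (∫ y in (0 : ℝ)..h, diffRemainder u x y * y ^ a) -
      h / 2 * (secondDiff u x (m * h) * (m * h) ^ a) +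
      d * h ^ (2 - α) * (powerTrapezoid α m - zetaConst α) -
      ∫ y in Ioi (m * h), secondDiff u x y * y ^ a := by
    rw [hδ, hsum, ← htail, hsumR, powerTrapezoid]
    rw [hmpow] at hrem
    linear_combination -hRm + hadj + hrem
  rw [hfinal]
  have b1 := abs_le.1 hcorr
  have b2 := abs_le.1 htrap
  have b3 := abs_le.1 hR1
  have b4 := abs_le.1 hfirst
  have b5 := abs_le.1 hend
  have b6 := abs_le.1 hpow'
  have b7 := abs_le.1 htail_le
  have c1 : K * h ^ (4 - α) ≤ K * h ^ 2 := by gcongr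
  have c2 : -zetaConst α * (4 * K * h ^ (4 - α)) ≤ -zetaConst α * (4 * K * h ^ 2) :=
    mul_le_mul_of_nonneg_left (by linarith) (by linarith)
  refine abs_le.2 ⟨?_, ?_⟩ <;> linarith

end HasBoundedDerivs

/-! ### The truncation error -/

theorem mul_rpow_neg_le_of_le {α h : ℝ} (hα₀ : 0 < α) (hα₂ : α < 2) (hh : 0 < h) {J m : ℕ}
    (hJ : 0 < J) (hm : J ≤ 4 * m) : ((m : ℝ) * h) ^ (-α) ≤ 16 * ((J : ℝ) * h) ^ (-α) := by
  have hJ0 : (0 : ℝ) < J := by exact_mod_cast hJ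
  have hJm : (J : ℝ) ≤ 4 * m := by exact_mod_cast hm
  have h1 : (4 : ℝ)⁻¹ ^ (-α) ≤ 16 := by
    rw [Real.inv_rpow (by norm_num), Real.rpow_neg (by norm_num), inv_inv]
    calc (4 : ℝ) ^ α ≤ (4 : ℝ) ^ (2 : ℝ) :=
          Real.rpow_le_rpow_of_exponent_le (by norm_num) hα₂.le
      _ = 16 := by norm_num
  calc ((m : ℝ) * h) ^ (-α) ≤ (4⁻¹ * (J * h)) ^ (-α) :=
        Real.rpow_le_rpow_of_nonpos (by positivity) (by nlinarith) (by linarith)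
    _ = (4 : ℝ)⁻¹ ^ (-α) * (J * h) ^ (-α) := Real.mul_rpow (by norm_num) (by positivity)
    _ ≤ _ := by gcongr

/-- The constant of the spatial discretization error, without the factor `K`. -/
noncomputable def spatialConst (α : ℝ) : ℝ :=
  (10 * (∫ y in Ioi 0, truncatedLevyDensity α y) + 6 - 4 * zetaConst α) + 16 * (7 + 8 / α)

theorem spatialConst_nonneg {α : ℝ} (hα₀ : 0 < α) (hα₂ : α < 2) : 0 ≤ spatialConst α := by
  have h1 := zetaConst_nonpos hα₀ hα₂
  have h2 : 0 ≤ ∫ y in Ioi 0, truncatedLevyDensity α y :=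
    setIntegral_nonneg measurableSet_Ioi fun y hy => truncatedLevyDensity_nonneg (le_of_lt hy)
  have h3 : 0 ≤ 8 / α := by positivity
  unfold spatialConst
  linarith

/-- The discrete nonlocal operator of the scheme, without the factor `ε C_α`. -/
noncomputable def discreteLevyOperator (α h : ℝ) (J : ℕ) (V : ℤ → ℝ) (j : ℤ) : ℝ :=
  -zetaConst α * h ^ (-α) * (V (j - 1) - 2 * V j + V (j + 1)) + h * trapezoidSum α h J V j

theorem eulerStep_eq (α ε h Δt : ℝ) (J : ℕ) (V : ℤ → ℝ) (j : ℤ) :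
    eulerStep α ε h Δt J V j = V j + Δt * (ε * levyConst α * discreteLevyOperator α h J V j) := by
  unfold eulerStep discreteLevyOperator
  ring

/-- Consistency of the discrete operator at the nodes with `|x_j| < 3L/4`, which have distance at
least `L/4` from the ends. -/
theorem HasBoundedDerivs.abs_discreteLevyOperator_sub_le {K : ℝ} {u : ℝ → ℝ}
    (hu : HasBoundedDerivs K u) {α h : ℝ} (hα₀ : 0 < α) (hα₂ : α < 2) (hh : 0 < h) (hh1 : h ≤ 1)
    {J : ℕ} (hJ : 0 < J) {j : ℤ} (hj : 4 * |j| < 3 * J) :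
    |discreteLevyOperator α h J (fun i => u (i * h)) j -
        ∫ y in Ioi 0, secondDiff u (j * h) y * y ^ (-(1 + α))| ≤
      K * spatialConst α * (h ^ 2 + (J * h) ^ (-α)) := by
  have hK := hu.nonneg
  have hζ := zetaConst_nonpos hα₀ hα₂
  obtain ⟨m, hm⟩ : ∃ m : ℕ, (m : ℤ) = J - |j| := ⟨(J - |j|).toNat, by omega⟩
  have hm1 : 1 ≤ m := by omega
  have hJm : J ≤ 4 * m := by omega
  set V : ℤ → ℝ := fun i => u (i * h) with hV
  have e1 : V (j - 1) - 2 * V j + V (j + 1) = secondDiff u (j * h) h := by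
    simp only [hV, secondDiff]
    push_cast
    rw [show ((j : ℝ) - 1) * h = j * h - h by ring, show ((j : ℝ) + 1) * h = j * h + h by ring]
    ring
  have e2 : ∀ k : ℕ, V (j + k) + V (j - k) - 2 * V j = secondDiff u (j * h) (k * h) := by
    intro k
    simp only [hV, secondDiff]
    push_cast
    rw [add_mul, sub_mul]
  have hB : ∀ i : ℤ, |i| ≤ J → |V i - V j| ≤ 2 * K := fun i _ => by
    have := abs_sub (V i) (V j)
    linarith [hu.abs_apply_le (i * h), hu.abs_apply_le (j * h)]
  have hsplit := abs_trapezoidSum_sub_le hα₀ hh hm1 hm hB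
  have hq := hu.abs_quadrature_sub_le hα₀ hα₂ hh hh1 hm1 (j * h)
  simp only [e2] at hsplit
  have hJα := mul_rpow_neg_le_of_le hα₀ hα₂ hh hJ hJm
  have hI : 0 ≤ ∫ y in Ioi 0, truncatedLevyDensity α y :=
    setIntegral_nonneg measurableSet_Ioi fun y hy => truncatedLevyDensity_nonneg (le_of_lt hy)
  set X := ((J : ℝ) * h) ^ (-α) with hX
  have hX0 : 0 ≤ X := by positivity
  set A := 10 * (∫ y in Ioi 0, truncatedLevyDensity α y) + 6 - 4 * zetaConst α with hA
  have hA0 : 0 ≤ A := by linarith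
  have hα' : 0 ≤ 8 / α := by positivity
  have htri : ∀ a b c d : ℝ, |a + b - d| ≤ |a + c - d| + |b - c| := fun a b c d => by
    have := abs_add_le (a + c - d) (b - c)
    rwa [show a + c - d + (b - c) = a + b - d by ring] at this
  rw [discreteLevyOperator, e1]
  refine (htri _ _ _ _).trans ((add_le_add hq hsplit).trans ?_)
  have step1 : K * (A * h ^ 2 + (3 + 4 / α) * (m * h) ^ (-α)) +
      2 * K * (2 * ((1 + 1 / α) * (m * h) ^ (-α))) =
      K * (A * h ^ 2 + (7 + 8 / α) * (m * h) ^ (-α)) := by ring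
  rw [step1, mul_assoc]
  refine mul_le_mul_of_nonneg_left ?_ hK
  have step2 : (7 + 8 / α) * (m * h) ^ (-α) ≤ (7 + 8 / α) * (16 * X) := by gcongr
  have step3 : 0 ≤ (16 * (7 + 8 / α)) * h ^ 2 := by positivity
  have step4 : 0 ≤ A * X := by positivity
  rw [spatialConst, ← hA]
  linarith

/-- Taylor estimate of first order, with the second derivative taken within `[0, T]`. -/
theorem abs_sub_sub_mul_le_of_iteratedDerivWithin {f f' : ℝ → ℝ} {K T : ℝ} (hT : 0 < T)
    (hf : ContDiffOn ℝ 2 f (Icc 0 T))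
    (hK : ∀ t ∈ Icc 0 T, |iteratedDerivWithin 2 f (Icc 0 T) t| ≤ K)
    (hf' : ∀ t ∈ Icc 0 T, HasDerivWithinAt f (f' t) (Icc 0 T) t) {t δ : ℝ} (ht : 0 ≤ t)
    (hδ : 0 ≤ δ) (htδ : t + δ ≤ T) : |f (t + δ) - f t - δ * f' t| ≤ K * δ ^ 2 := by
  have hu : UniqueDiffOn ℝ (Icc 0 T) := uniqueDiffOn_Icc hT
  have htI : t ∈ Icc 0 T := ⟨ht, by linarith⟩
  have hd1 : ∀ s ∈ Icc 0 T, iteratedDerivWithin 1 f (Icc 0 T) s = f' s := fun s hs => by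
    rw [iteratedDerivWithin_one]
    exact (hf' s hs).derivWithin (hu s hs)
  have hdiff := hf.differentiableOn_iteratedDerivWithin (m := 1) (by norm_num) hu
  have hsub : Icc t (t + δ) ⊆ Icc 0 T := Icc_subset_Icc ht htδ
  have hL : ∀ s ∈ Icc t (t + δ), |f' s - f' t| ≤ K * δ := by
    intro s hs
    have h1 := Convex.norm_image_sub_le_of_norm_derivWithin_le (C := K) hdiff (fun r hr => by
      rw [← iteratedDerivWithin_succ]
      exact hK r hr) (convex_Icc 0 T) htI (hsub hs)
    rw [hd1 _ htI, hd1 _ (hsub hs), Real.norm_eq_abs, Real.norm_eq_abs,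
      abs_of_nonneg (sub_nonneg.2 hs.1)] at h1
    have hK0 : 0 ≤ K := (abs_nonneg _).trans (hK t htI)
    exact h1.trans (by gcongr; linarith [hs.2])
  have h2 := Convex.norm_image_sub_le_of_norm_hasDerivWithin_le (𝕜 := ℝ)
    (f := fun s => f s - s * f' t) (f' := fun s => f' s - f' t) (s := Icc t (t + δ)) (x := t)
    (y := t + δ) (C := K * δ)
    (fun s hs => by
      have := ((hf' s (hsub hs)).mono hsub).fun_sub
        ((hasDerivAt_id' s).hasDerivWithinAt.mul_const (f' t))
      rwa [one_mul] at this)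
    hL (convex_Icc _ _) (left_mem_Icc.2 (by linarith)) (right_mem_Icc.2 (by linarith))
  rw [Real.norm_eq_abs, Real.norm_eq_abs, add_sub_cancel_left, abs_of_nonneg hδ] at h2
  calc |f (t + δ) - f t - δ * f' t| = |f (t + δ) - (t + δ) * f' t - (f t - t * f' t)| := by
        congr 1; ring
    _ ≤ K * δ * δ := h2
    _ = K * δ ^ 2 := by ring

theorem IsBoundedSmooth.hasBoundedDerivs {K T : ℝ} {p : ℝ → ℝ → ℝ} (hp : IsBoundedSmooth K T p)
    {t : ℝ} (ht : t ∈ Icc 0 T) : HasBoundedDerivs K fun x => p x t :=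
  ⟨hp.contDiff_space t ht, hp.bound_space t ht⟩

/-- The constant of the truncation error at the nodes with `|x_j| < 3L/4`. -/
noncomputable def truncationConst (α ε K : ℝ) : ℝ := K * (1 + ε * levyConst α * spatialConst α)

theorem abs_truncationError_le {α ε K T h Δt : ℝ} {p : ℝ → ℝ → ℝ} {J n : ℕ} {j : ℤ}
    (hα₀ : 0 < α) (hα₂ : α < 2) (hε : 0 < ε) (hT : 0 < T) (hp : IsNaturalSolution α ε T p)
    (hs : IsBoundedSmooth K T p) (hh : 0 < h) (hh1 : h ≤ 1) (hJ : 0 < J) (hΔ : 0 < Δt)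
    (hn : (n + 1) * Δt ≤ T) (hj : 4 * |j| < 3 * J) :
    |truncationError α ε h Δt J p n j| ≤
      truncationConst α ε K * (Δt + h ^ 2 + (J * h) ^ (-α)) := by
  have hnΔ : 0 ≤ (n : ℝ) * Δt := by positivity
  have ht : (n : ℝ) * Δt ∈ Icc 0 T := ⟨hnΔ, by linarith⟩
  have hu := hs.hasBoundedDerivs ht
  have hK := hu.nonneg
  have hc := levyConst_pos hα₀ hα₂
  have hS := spatialConst_nonneg hα₀ hα₂
  have htime := abs_sub_sub_mul_le_of_iteratedDerivWithin hT (hs.contDiff_time (j * h))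
    (hs.bound_time (j * h)) (hp.equation (j * h)) hnΔ hΔ.le (by linarith)
  have hspace := hu.abs_discreteLevyOperator_sub_le hα₀ hα₂ hh hh1 hJ hj
  rw [hu.fokkerPlanckRHS_eq hα₀ hα₂, show (n : ℝ) * Δt + Δt = (n + 1) * Δt by ring] at htime
  rw [truncationError, eulerStep_eq, abs_div, abs_of_pos hΔ, div_le_iff₀ hΔ]
  set D := discreteLevyOperator α h J (fun i => p (i * h) (n * Δt)) j with hD
  set I := ∫ y in Ioi 0, secondDiff (fun x => p x (n * Δt)) (j * h) y * y ^ (-(1 + α)) with hI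
  have hX : 0 ≤ ((J : ℝ) * h) ^ (-α) := by positivity
  have e : p (j * h) ((n + 1) * Δt) - (p (j * h) (n * Δt) + Δt * (ε * levyConst α * D)) =
      (p (j * h) ((n + 1) * Δt) - p (j * h) (n * Δt) - Δt * (ε * levyConst α * I)) -
        Δt * (ε * levyConst α) * (D - I) := by ring
  rw [e]
  refine (abs_sub _ _).trans ?_
  rw [abs_mul, abs_of_pos (show 0 < Δt * (ε * levyConst α) by positivity)]
  calc _ ≤ K * Δt ^ 2 + Δt * (ε * levyConst α) *
        (K * spatialConst α * (h ^ 2 + (J * h) ^ (-α))) := by gcongr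
    _ ≤ K * Δt ^ 2 + Δt * (ε * levyConst α) *
        (K * spatialConst α * (h ^ 2 + (J * h) ^ (-α))) +
        (K * Δt * (h ^ 2 + (J * h) ^ (-α)) +
          Δt * (ε * levyConst α) * (K * spatialConst α) * Δt) := by
        refine le_add_of_nonneg_right ?_
        positivity
    _ = _ := by rw [truncationConst]; ring

/-! ### The barrier and the error bound with rate -/

/-- The grid function `16 dist(z, [-1/2, 1/2])²` at `z = i / J = x_i / L`. It vanishes for
`|x_i| ≤ L/2`, is at least `1` for `|x_i| ≥ 3L/4`, and the discrete operator maps it to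
`O(L^(-α))`. -/
noncomputable def barrier (J : ℕ) (i : ℤ) : ℝ := 16 * max 0 (|(i : ℝ)| / J - 1 / 2) ^ 2

theorem barrier_nonneg (J : ℕ) (i : ℤ) : 0 ≤ barrier J i := by unfold barrier; positivity

theorem barrier_le_four {J : ℕ} (hJ : 0 < J) {i : ℤ} (hi : |i| ≤ J) : barrier J i ≤ 4 := by
  have hJ0 : (0 : ℝ) < J := by exact_mod_cast hJ
  have h1 : |(i : ℝ)| / J ≤ 1 := (div_le_one hJ0).2 (by exact_mod_cast hi)
  have h2 : max 0 (|(i : ℝ)| / J - 1 / 2) ≤ 1 / 2 := max_le (by norm_num) (by linarith)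
  unfold barrier
  calc _ ≤ 16 * (1 / 2 : ℝ) ^ 2 := by gcongr
    _ = 4 := by norm_num

theorem one_le_barrier {J : ℕ} (hJ : 0 < J) {i : ℤ} (hi : 3 * J ≤ 4 * |i|) : 1 ≤ barrier J i := by
  have hJ0 : (0 : ℝ) < J := by exact_mod_cast hJ
  have h0 : (3 : ℝ) * J ≤ 4 * |(i : ℝ)| := by exact_mod_cast hi
  have h1 : 3 / 4 ≤ |(i : ℝ)| / J := (le_div_iff₀ hJ0).2 (by linarith)
  have h2 : 1 / 4 ≤ max 0 (|(i : ℝ)| / J - 1 / 2) := le_max_of_le_right (by linarith)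
  unfold barrier
  calc (1 : ℝ) = 16 * (1 / 4) ^ 2 := by norm_num
    _ ≤ _ := by gcongr

theorem barrier_eq_zero {J : ℕ} (hJ : 0 < J) {i : ℤ} (hi : 2 * |i| ≤ J) : barrier J i = 0 := by
  have hJ0 : (0 : ℝ) < J := by exact_mod_cast hJ
  have h0 : (2 : ℝ) * |(i : ℝ)| ≤ J := by exact_mod_cast hi
  have h1 : |(i : ℝ)| / J ≤ 1 / 2 := (div_le_iff₀ hJ0).2 (by linarith)
  rw [barrier, max_eq_left (by linarith)]
  norm_num

/-- The squared distance to a closed convex set has second differences at most `2 y²`, here for the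
interval `[-1/2, 1/2]`. -/
theorem sq_max_add_sq_max_le (z y : ℝ) :
    max 0 (|z + y| - 1 / 2) ^ 2 + max 0 (|z - y| - 1 / 2) ^ 2 - 2 * max 0 (|z| - 1 / 2) ^ 2 ≤
      2 * y ^ 2 := by
  -- `max 0 (|w| - 1/2)` is the distance from `w` to `[-1/2, 1/2]`; for the three
  -- points compare with the projection `c` of `z`
  have key : ∀ c w : ℝ, |c| ≤ 1 / 2 → max 0 (|w| - 1 / 2) ^ 2 ≤ (w - c) ^ 2 := by
    intro c w hc
    rw [← sq_abs (w - c)]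
    refine pow_le_pow_left₀ (le_max_left _ _) (max_le (abs_nonneg _) ?_) 2
    linarith [abs_sub_abs_le_abs_sub w c]
  obtain ⟨c, hc, hz⟩ : ∃ c : ℝ, |c| ≤ 1 / 2 ∧ max 0 (|z| - 1 / 2) ^ 2 = (z - c) ^ 2 := by
    rcases le_total |z| (1 / 2) with h | h
    · exact ⟨z, h, by rw [max_eq_left (by linarith)]; ring⟩
    · rcases le_total 0 z with hz | hz
      · refine ⟨1 / 2, by norm_num, ?_⟩
        rw [abs_of_nonneg hz] at h ⊢
        rw [max_eq_right (by linarith)]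
      · refine ⟨-(1 / 2), by norm_num, ?_⟩
        rw [abs_of_nonpos hz] at h ⊢
        rw [max_eq_right (by linarith)]; ring
  have h1 := key c (z + y) hc
  have h2 := key c (z - y) hc
  rw [hz]
  linarith

theorem barrier_secondDiff_le {J : ℕ} (j k : ℤ) :
    barrier J (j + k) + barrier J (j - k) - 2 * barrier J j ≤ 32 * ((k : ℝ) / J) ^ 2 := by
  have h := sq_max_add_sq_max_le ((j : ℝ) / J) ((k : ℝ) / J)
  have e : ∀ i : ℤ, barrier J i = 16 * max 0 (|(i : ℝ) / J| - 1 / 2) ^ 2 := fun i => by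
    rw [barrier, abs_div, Nat.abs_cast]
  rw [e, e, e]
  push_cast
  rw [add_div, sub_div]
  linarith

/-- The constant in the bound for the discrete operator applied to the barrier. -/
noncomputable def barrierConst (α : ℝ) : ℝ :=
  32 * (-zetaConst α) + 32 / (2 - α) + 128 * (1 + 1 / α)

theorem barrierConst_nonneg {α : ℝ} (hα₀ : 0 < α) (hα₂ : α < 2) : 0 ≤ barrierConst α := by
  have h1 := zetaConst_nonpos hα₀ hα₂
  have h2 : 0 < 2 - α := by linarith
  have h3 : 0 ≤ -zetaConst α := by linarith
  unfold barrierConst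
  positivity

theorem discreteLevyOperator_barrier_le {α h : ℝ} (hα₀ : 0 < α) (hα₂ : α < 2) (hh : 0 < h)
    {J : ℕ} (hJ : 0 < J) {j : ℤ} (hj : 4 * |j| < 3 * J) :
    discreteLevyOperator α h J (barrier J) j ≤ barrierConst α * (J * h) ^ (-α) := by
  have hζ := zetaConst_nonpos hα₀ hα₂
  have hJ1 : (1 : ℝ) ≤ J := by exact_mod_cast hJ
  have hJ0 : (0 : ℝ) < J := by linarith
  have h2α : 0 < 2 - α := by linarith
  obtain ⟨m, hm⟩ : ∃ m : ℕ, (m : ℤ) = J - |j| := ⟨(J - |j|).toNat, by omega⟩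
  have hm1 : 1 ≤ m := by omega
  have hmJ : (m : ℝ) ≤ J := by exact_mod_cast (show m ≤ J by have := abs_nonneg j; omega)
  have hB : ∀ i : ℤ, |i| ≤ J → |barrier J i - barrier J j| ≤ 4 := fun i hi =>
    abs_sub_le_of_nonneg_of_le (barrier_nonneg J i) (barrier_le_four hJ hi) (barrier_nonneg J j)
      (barrier_le_four hJ (by omega))
  have hsplit := (abs_le.1 (abs_trapezoidSum_sub_le hα₀ hh hm1 hm hB)).2
  have hJα := mul_rpow_neg_le_of_le hα₀ hα₂ hh hJ (show J ≤ 4 * m by omega)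
  have hX : ((J : ℝ) * h) ^ (-α) = (J : ℝ) ^ (-α) * h ^ (-α) := Real.mul_rpow hJ0.le hh.le
  have hhα : 0 < h ^ (-α) := by positivity
  have hcorr : -zetaConst α * h ^ (-α) *
      (barrier J (j - 1) - 2 * barrier J j + barrier J (j + 1)) ≤
      32 * (-zetaConst α) * (J * h) ^ (-α) := by
    have h1 := barrier_secondDiff_le (J := J) j 1
    have h2 : ((1 : ℤ) / J : ℝ) ^ 2 ≤ (J : ℝ) ^ (-α) := by
      have : ((1 : ℤ) / J : ℝ) ^ 2 = (J : ℝ) ^ (-2 : ℝ) := by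
        rw [Real.rpow_neg hJ0.le]; simp
      rw [this]
      exact Real.rpow_le_rpow_of_exponent_le hJ1 (by linarith)
    calc _ ≤ -zetaConst α * h ^ (-α) * (32 * (J : ℝ) ^ (-α)) :=
          mul_le_mul_of_nonneg_left (by linarith) (mul_nonneg (by linarith) hhα.le)
      _ = _ := by rw [hX]; ring
  have hnear : h * ∑ k ∈ Finset.Ico 1 m, (barrier J (j + k) + barrier J (j - k) -
      2 * barrier J j) / ((k : ℝ) * h) ^ (1 + α) ≤ 32 / (2 - α) * (J * h) ^ (-α) := by
    have h1 : ∀ k ∈ Finset.Ico 1 m, h * ((barrier J (j + k) + barrier J (j - k) -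
        2 * barrier J j) / ((k : ℝ) * h) ^ (1 + α)) ≤
        32 * h ^ (-α) * (J : ℝ) ^ (-2 : ℝ) * (k : ℝ) ^ (1 - α) := by
      intro k hk
      have hk0 : (0 : ℝ) < k := by exact_mod_cast (Finset.mem_Ico.1 hk).1
      have h2 := barrier_secondDiff_le (J := J) j k
      have e1 : h * (h ^ (1 + α))⁻¹ = h ^ (-α) := by
        rw [← Real.rpow_neg hh.le, ← Real.rpow_one_add' hh.le (by linarith)]; congr 1; ring
      have e2 : (k : ℝ) ^ 2 * ((k : ℝ) ^ (1 + α))⁻¹ = (k : ℝ) ^ (1 - α) := by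
        rw [← Real.rpow_neg hk0.le, ← Real.rpow_natCast, ← Real.rpow_add hk0]
        congr 1; push_cast; ring
      have e3 : (J : ℝ) ^ (-2 : ℝ) = ((J : ℝ) ^ 2)⁻¹ := by rw [Real.rpow_neg hJ0.le]; simp
      calc _ ≤ h * (32 * (((k : ℤ) : ℝ) / J) ^ 2 / ((k : ℝ) * h) ^ (1 + α)) := by gcongr
        _ = 32 * (h * (h ^ (1 + α))⁻¹) * ((J : ℝ) ^ 2)⁻¹ *
            ((k : ℝ) ^ 2 * ((k : ℝ) ^ (1 + α))⁻¹) := by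
          rw [Real.mul_rpow hk0.le hh.le, Int.cast_natCast]
          field_simp
        _ = _ := by rw [e1, e2, e3]
    rw [Finset.mul_sum]
    refine (Finset.sum_le_sum h1).trans ?_
    rw [← Finset.mul_sum]
    calc _ ≤ 32 * h ^ (-α) * (J : ℝ) ^ (-2 : ℝ) * ((m : ℝ) ^ (2 - α) / (2 - α)) := by
          gcongr; exact sum_rpow_one_sub_le hα₀ hα₂ hm1
      _ ≤ 32 * h ^ (-α) * (J : ℝ) ^ (-2 : ℝ) * ((J : ℝ) ^ (2 - α) / (2 - α)) := by gcongr
      _ = 32 / (2 - α) * (((J : ℝ) ^ (-2 : ℝ) * (J : ℝ) ^ (2 - α)) * h ^ (-α)) := by ring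
      _ = _ := by rw [← Real.rpow_add hJ0, hX]; congr 3; ring
  have hfar : 4 * (2 * ((1 + 1 / α) * (m * h) ^ (-α))) ≤
      128 * (1 + 1 / α) * (J * h) ^ (-α) := by
    calc _ ≤ 4 * (2 * ((1 + 1 / α) * (16 * (J * h) ^ (-α)))) := by gcongr
      _ = _ := by ring
  rw [discreteLevyOperator, barrierConst]
  linarith

/-- Maximum principle: numerical solutions are bounded by their initial and end values. -/
theorem IsNumericalSolution.abs_le {α ε h Δt M K : ℝ} {J : ℕ} {p : ℝ → ℝ → ℝ} {U : ℕ → ℤ → ℝ}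
    (hU : IsNumericalSolution α ε h Δt M J p U)
    (hα₀ : 0 < α) (hα₂ : α < 2) (hε : 0 < ε) (hh : 0 < h) (hΔ : 0 < Δt)
    (hstep : StepCondition α ε h Δt) (hp : ∀ x, |p x 0| ≤ K) (n : ℕ) {j : ℤ} (hj : |j| ≤ J) :
    |U n j| ≤ K + |M| := by
  have hK : 0 ≤ K := (abs_nonneg _).trans (hp 0)
  have hend : ∀ n (j : ℤ), |j| = J → |U n j| ≤ K + |M| := fun n j hj =>
    (hU.ends n j hj).trans (by linarith [le_abs_self M])
  induction n generalizing j with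
  | zero =>
    rcases hj.lt_or_eq with hj | hj
    · rw [hU.initial j hj]; linarith [hp (j * h), abs_nonneg M]
    · exact hend _ j hj
  | succ n ih =>
    rcases hj.lt_or_eq with hj | hj
    · rw [hU.step n j hj]
      have := abs_eulerStep_le (V := U n) (W := fun _ => K + |M|) hα₀ hα₂ hε hh hΔ hstep
        (fun i hi => ih hi) hj
      rwa [eulerStep_const] at this
    · exact hend _ j hj

/-- The constant of the error bound with rate: the truncation error plus the leakage from the region
near the ends, where the error is at most `2K + |M|`. -/
noncomputable def rateConst (α ε K M : ℝ) : ℝ :=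
  truncationConst α ε K + (2 * K + |M|) * (ε * levyConst α * barrierConst α)

theorem truncationConst_nonneg {α ε K : ℝ} (hα₀ : 0 < α) (hα₂ : α < 2) (hε : 0 < ε) (hK : 0 ≤ K) :
    0 ≤ truncationConst α ε K := by
  have hc := levyConst_pos hα₀ hα₂
  have hS := spatialConst_nonneg hα₀ hα₂
  unfold truncationConst; positivity

theorem truncationConst_le_rateConst {α ε K M : ℝ} (hα₀ : 0 < α) (hα₂ : α < 2) (hε : 0 < ε)
    (hK : 0 ≤ K) : truncationConst α ε K ≤ rateConst α ε K M := by
  have hc := levyConst_pos hα₀ hα₂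
  have hB := barrierConst_nonneg hα₀ hα₂
  unfold rateConst
  refine le_add_of_nonneg_right ?_
  positivity

/-- Comparison of the error with `t_n C T̄ + (2K + |M|) · barrier`. Where the barrier is at least
`1`, the trivial bound of the error suffices; elsewhere the truncation error is under control and
the Euler step is monotone. -/
theorem abs_gridError_le_add_barrier {α ε K M T h Δt : ℝ} {p : ℝ → ℝ → ℝ} {J : ℕ}
    {U : ℕ → ℤ → ℝ} (hα₀ : 0 < α) (hα₂ : α < 2) (hε : 0 < ε) (hT : 0 < T)
    (hp : IsNaturalSolution α ε T p) (hs : IsBoundedSmooth K T p) (hh : 0 < h) (hh1 : h ≤ 1)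
    (hJ : 0 < J) (hΔ : 0 < Δt) (hstep : StepCondition α ε h Δt)
    (hU : IsNumericalSolution α ε h Δt M J p U) {n : ℕ} (hn : n * Δt ≤ T) {j : ℤ} (hj : |j| ≤ J) :
    |gridError h Δt p U n j| ≤
      n * Δt * (rateConst α ε K M * (Δt + h ^ 2 + (J * h) ^ (-α))) +
        (2 * K + |M|) * barrier J j := by
  have h0T : (0 : ℝ) ∈ Icc 0 T := ⟨le_rfl, hT.le⟩
  have hK : 0 ≤ K := (hs.hasBoundedDerivs h0T).nonneg
  have hc := levyConst_pos hα₀ hα₂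
  have hBc := barrierConst_nonneg hα₀ hα₂
  have hR : 0 ≤ rateConst α ε K M :=
    (truncationConst_nonneg hα₀ hα₂ hε hK).trans (truncationConst_le_rateConst hα₀ hα₂ hε hK)
  set τ := Δt + h ^ 2 + (J * h) ^ (-α) with hτ
  have hX : 0 ≤ (J * h) ^ (-α) := by positivity
  have hτX : (J * h) ^ (-α) ≤ τ := by
    have := sq_nonneg h; rw [hτ]; linarith
  have hτ0 : 0 ≤ τ := hX.trans hτX
  set B := 2 * K + |M| with hB
  have hB0 : 0 ≤ B := by positivity
  induction n generalizing j with
  | zero =>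
    have hbar := barrier_nonneg J j
    rcases hj.lt_or_eq with hj | hj
    · rw [gridError_zero hU hj, abs_zero]; positivity
    · have h1 := hU.ends 0 j hj
      have h2 := (hs.hasBoundedDerivs h0T).abs_apply_le (j * h)
      have h3 := one_le_barrier hJ (i := j) (by omega)
      have h4 : B * 1 ≤ B * barrier J j := by gcongr
      have h5 := abs_sub (U 0 j) (p (j * h) 0)
      simp only [gridError, CharP.cast_eq_zero, zero_mul, zero_add]
      linarith [le_abs_self M]
  | succ n ih =>
    have hn' : (n + 1) * Δt ≤ T := by exact_mod_cast hn
    rcases le_or_gt (3 * (J : ℤ)) (4 * |j|) with hj3 | hj3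
    · have ht : ((n + 1 : ℕ) : ℝ) * Δt ∈ Icc 0 T := ⟨by positivity, hn⟩
      have h1 := hU.abs_le hα₀ hα₂ hε hh hΔ hstep
        (fun x => (hs.hasBoundedDerivs h0T).abs_apply_le x) (n + 1) hj
      have h2 := (hs.hasBoundedDerivs ht).abs_apply_le (j * h)
      have h3 := one_le_barrier hJ hj3
      have h4 : B * 1 ≤ B * barrier J j := by gcongr
      have h5 := abs_sub (U (n + 1) j) (p (j * h) ((n + 1 : ℕ) * Δt))
      have h6 : 0 ≤ ((n + 1 : ℕ) : ℝ) * Δt * (rateConst α ε K M * τ) := by positivity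
      simp only [gridError]
      linarith
    · have hjJ : |j| < J := by omega
      rw [gridError_succ hΔ hU n hjJ]
      set w : ℤ → ℝ := fun i => n * Δt * (rateConst α ε K M * τ) * 1 + B * barrier J i with hw
      have h1 := abs_eulerStep_le (V := gridError h Δt p U n) (W := w) hα₀ hα₂ hε hh hΔ hstep
        (fun i hi => by
          rw [hw]; simp only [mul_one]
          exact ih (by linarith) hi) hjJ
      rw [hw, eulerStep_lin, eulerStep_const, eulerStep_eq α ε h Δt J (barrier J)] at h1
      have h2 := abs_truncationError_le hα₀ hα₂ hε hT hp hs hh hh1 hJ hΔ hn' hj3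
      have h3 : |Δt * truncationError α ε h Δt J p n j| ≤ Δt * (truncationConst α ε K * τ) := by
        rw [abs_mul, abs_of_pos hΔ]; gcongr
      have h4 := abs_sub (eulerStep α ε h Δt J (gridError h Δt p U n) j)
        (Δt * truncationError α ε h Δt J p n j)
      have h5 : B * (Δt * (ε * levyConst α * discreteLevyOperator α h J (barrier J) j)) ≤
          B * (Δt * (ε * levyConst α * (barrierConst α * τ))) := by
        gcongr
        exact (discreteLevyOperator_barrier_le hα₀ hα₂ hh hJ hj3).trans (by gcongr)
      have h6 : ((n + 1 : ℕ) : ℝ) * Δt * (rateConst α ε K M * τ) =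
          n * Δt * (rateConst α ε K M * τ) + Δt * (truncationConst α ε K * τ) +
          B * (Δt * (ε * levyConst α * (barrierConst α * τ))) := by
        rw [rateConst]; push_cast; ring
      rw [h6]
      linarith

theorem abs_gridError_le {α ε K M T h Δt : ℝ} {p : ℝ → ℝ → ℝ} {J : ℕ}
    {U : ℕ → ℤ → ℝ} (hα₀ : 0 < α) (hα₂ : α < 2) (hε : 0 < ε) (hT : 0 < T)
    (hp : IsNaturalSolution α ε T p) (hs : IsBoundedSmooth K T p) (hh : 0 < h) (hh1 : h ≤ 1)
    (hJ : 0 < J) (hΔ : 0 < Δt) (hstep : StepCondition α ε h Δt)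
    (hU : IsNumericalSolution α ε h Δt M J p U) {n : ℕ} (hn : n * Δt ≤ T) {j : ℤ}
    (hj : 2 * |j| ≤ J) :
    |gridError h Δt p U n j| ≤
      n * Δt * (rateConst α ε K M * (Δt + h ^ 2 + (J * h) ^ (-α))) := by
  have := abs_gridError_le_add_barrier hα₀ hα₂ hε hT hp hs hh hh1 hJ hΔ hstep hU hn
    (j := j) (by have := abs_nonneg j; omega)
  rwa [barrier_eq_zero hJ hj, mul_zero, add_zero] at this

theorem two_mul_abs_le_of_abs_mul_le {h : ℝ} (hh : 0 < h) {J : ℕ} {j : ℤ}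
    (hj : |(j : ℝ) * h| ≤ J * h / 2) : 2 * |j| ≤ (J : ℤ) := by
  rw [abs_mul, abs_of_pos hh] at hj
  have : 2 * |(j : ℝ)| ≤ J := le_of_mul_le_mul_right (by linarith) hh
  exact_mod_cast this

theorem tendsto_of_stepCondition {α ε : ℝ} (hα₀ : 0 < α) {h Δt : ℕ → ℝ} (hh : ∀ m, 0 < h m)
    (hΔ : ∀ m, 0 < Δt m) (hstep : ∀ m, StepCondition α ε (h m) (Δt m))
    (hlim : Tendsto h atTop (𝓝 0)) : Tendsto Δt atTop (𝓝 0) := by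
  set c := 1 / (2 * ε * levyConst α * (1 + 1 / α - zetaConst α)) with hc
  have h1 : Tendsto (fun m => c * h m ^ α) atTop (𝓝 0) := by
    have := (hlim.rpow_const (p := α) (Or.inr hα₀.le)).const_mul c
    rwa [Real.zero_rpow hα₀.ne', mul_zero] at this
  exact squeeze_zero (fun m => (hΔ m).le)
    (fun m => (div_le_iff₀ (Real.rpow_pos_of_pos (hh m) α)).1 (hstep m)) h1

end NonlocalFP

open NonlocalFP

theorem proposition4p4 (α ε K M : ℝ) (hα₀ : 0 < α) (hα₂ : α < 2) (hε : 0 < ε) :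
    ∃ C : ℝ, 0 ≤ C ∧ ∀ (T : ℝ) (p : ℝ → ℝ → ℝ), 0 < T →
      IsNaturalSolution α ε T p → IsBoundedSmooth K T p →
      -- truncation error, for `L = J h`
      (∀ (h Δt : ℝ) (J : ℕ), 0 < h → h ≤ 1 → 1 ≤ J * h → 0 < Δt →
        ∀ (n : ℕ) (j : ℤ), (n + 1) * Δt ≤ T → |j * h| ≤ J * h / 2 →
          |truncationError α ε h Δt J p n j| ≤ C * (Δt + h ^ 2 + (J * h) ^ (-α))) ∧
      -- error bound on the whole grid in terms of a bound of the truncation error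
      (∀ (h Δt : ℝ) (J : ℕ), 0 < h → 0 < J → 0 < Δt → StepCondition α ε h Δt →
        ∀ U : ℕ → ℤ → ℝ, IsNumericalSolution α ε h Δt M J p U →
        ∀ (n : ℕ) (τ β : ℝ),
          (∀ m < n, ∀ j : ℤ, |j| < (J : ℤ) → |truncationError α ε h Δt J p m j| ≤ τ) →
          (∀ m ≤ n, ∀ j : ℤ, |j| = (J : ℤ) → |gridError h Δt p U m j| ≤ β) →
          ∀ j : ℤ, |j| ≤ (J : ℤ) → |gridError h Δt p U n j| ≤ β + n * Δt * τ) ∧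
      -- error bound with the rate, at the grid points of `[-L/2, L/2]`
      (∀ (h Δt : ℝ) (J : ℕ), 0 < h → h ≤ 1 → 1 ≤ J * h → 0 < Δt → StepCondition α ε h Δt →
        ∀ U : ℕ → ℤ → ℝ, IsNumericalSolution α ε h Δt M J p U →
        ∀ (n : ℕ) (j : ℤ), n * Δt ≤ T → |j * h| ≤ J * h / 2 →
          |gridError h Δt p U n j| ≤ n * Δt * (C * (Δt + h ^ 2 + (J * h) ^ (-α)))) ∧
      -- convergence along every refinement path
      (∀ (h Δt : ℕ → ℝ) (J : ℕ → ℕ) (U : ℕ → ℕ → ℤ → ℝ),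
        (∀ m, 0 < h m) → (∀ m, 0 < Δt m) → (∀ m, StepCondition α ε (h m) (Δt m)) →
        Tendsto h atTop (𝓝 0) → Tendsto (fun m => J m * h m) atTop atTop →
        (∀ m, IsNumericalSolution α ε (h m) (Δt m) M (J m) p (U m)) →
        ∀ δ > 0, ∀ᶠ m in atTop, ∀ (n : ℕ) (j : ℤ),
          n * Δt m ≤ T → |j * h m| ≤ J m * h m / 2 →
          |gridError (h m) (Δt m) p (U m) n j| < δ) := by
  -- a negative `K` admits no solution, so the constant for `|K|` serves in all cases
  have hC : 0 ≤ rateConst α ε |K| M :=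
    (truncationConst_nonneg hα₀ hα₂ hε (abs_nonneg K)).trans
      (truncationConst_le_rateConst hα₀ hα₂ hε (abs_nonneg K))
  refine ⟨rateConst α ε |K| M, hC, fun T p hT hp hs => ?_⟩
  have hK : 0 ≤ K := (hs.hasBoundedDerivs (t := 0) ⟨le_rfl, hT.le⟩).nonneg
  rw [abs_of_nonneg hK] at hC ⊢
  have hJpos : ∀ {h : ℝ} {J : ℕ}, 1 ≤ J * h → 0 < J := fun {h J} hJ =>
    Nat.pos_of_ne_zero fun h0 => by rw [h0, Nat.cast_zero, zero_mul] at hJ; linarith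
  refine ⟨?_, ?_, ?_, ?_⟩
  · intro h Δt J hh hh1 hJ hΔ n j hn hj
    have hJ0 := hJpos hJ
    have hj2 := two_mul_abs_le_of_abs_mul_le hh hj
    refine (abs_truncationError_le hα₀ hα₂ hε hT hp hs hh hh1 hJ0 hΔ hn (by omega)).trans ?_
    gcongr
    exact truncationConst_le_rateConst hα₀ hα₂ hε hK
  · intro h Δt J hh hJ hΔ hstep U hU n τ β hτ hβ j hj
    exact abs_gridError_le_of_truncationError_le hα₀ hα₂ hε hh hJ hΔ hstep hU hτ hβ hj
  · intro h Δt J hh hh1 hJ hΔ hstep U hU n j hn hj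
    exact abs_gridError_le hα₀ hα₂ hε hT hp hs hh hh1 (hJpos hJ) hΔ hstep hU hn
      (two_mul_abs_le_of_abs_mul_le hh hj)
  · intro h Δt J U hh hΔ hstep hlim hL hU δ hδ
    have hΔlim := tendsto_of_stepCondition hα₀ hh hΔ hstep hlim
    have hrate : Tendsto (fun m => T * (rateConst α ε K M *
        (Δt m + h m ^ 2 + (J m * h m) ^ (-α)))) atTop (𝓝 0) := by
      have h1 := (hΔlim.add (hlim.pow 2)).add ((tendsto_rpow_neg_atTop hα₀).comp hL)
      have h2 := (h1.const_mul (rateConst α ε K M)).const_mul T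
      simpa using h2
    filter_upwards [hrate.eventually_lt_const hδ, hlim.eventually_le_const one_pos,
      hL.eventually_ge_atTop 1] with m hm hm1 hmJ n j hn hj
    refine lt_of_le_of_lt (abs_gridError_le hα₀ hα₂ hε hT hp hs (hh m) hm1 (hJpos hmJ) (hΔ m)
      (hstep m) (hU m) hn (two_mul_abs_le_of_abs_mul_le (hh m) hj)) (lt_of_le_of_lt ?_ hm)
    have hX : 0 ≤ (J m * h m) ^ (-α) := Real.rpow_nonneg (by linarith) _
    have := (hΔ m).le
    gcongr
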